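/- **Setting.** Let $C$ be a CSS code on $n$ qubits, given by $X$- and $Z$-type stabilizer generators (supports $S_{X,p}$, $S_{Z,q}$ with $|S_{X,p}\cap S_{Z,q}|$ even), and let $L\ge 0$. The foliation of $C$ with $L$ rounds takes an $n$-qubit input through layers $t=1,\dots,2L$. In layer $t$, (i) every code qubit $i$ is teleported onto a fresh physical qubit $(i,t)$, prepared in $|+\rangle$, by a CZ gate with $(i,t-1)$ and an $X$-basis measurement of $(i,t-1)$ with outcome $m_{i,t}$; (ii) every $X$-type generator ($t$ odd), respectively $Z$-type generator ($t$ even), is measured by an ancilla prepared in $|+\rangle$, CZ gates (in any order) with the qubits $(i,t)$ in its support, and an $X$-basis measurement of the ancilla with outcome $s_{a,t}$. The space-time locations are: after each preparation, and on each of the two qubits after each CZ gate, for all ancillas and all qubits $(i,t)$ with $1\le t\le 2L$ (the input qubits $(i,0)$ carry no noise). For a physical qubit $\gamma$ (a code qubit in layer $t$, or the ancilla of a generator in layer $t$) let $W_\gamma$ be the number of its locations. At each location $\mathcal L$ a single-qubit channel $\mathcal N_{\mathcal L}$ acts. For given outcomes $\sigma$ of the cluster-state stabilizers, $\sigma_{a,t}=s_{a,t}+s_{a,t-2}+\sum_{i\in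 S_a}m_{i,t} \bmod 2$ (with $s_{a,t-2}=0$ in the first round), let $\mathcal E_\sigma[\{\mathcal N_{\mathcal L}\}](\rho)$ be the sum, over all measurement outcomes $(m,s)$ that yield $\sigma$, of the unnormalized output states after undoing the Pauli frame $\prod_i X_i^{m_{i,2}+m_{i,4}+\cdots+m_{i,2L}}Z_i^{m_{i,1}+m_{i,3}+\cdots+m_{i,2L-1}}$. Two noise models are *equivalent on the foliated code* if $\mathcal E_\sigma(\rho)$ is the same for all $\sigma$ and all operators $\rho$ supported on the code space. Write $[\mathcal N]_{P,P'}=\tfrac12\mathrm{Tr}[P^\dagger\mathcal N(P')]$ for the Pauli transfer matrix, $\mathcal P_z[p](\rho)=(1-p)\rho+pZ\rho Z$ and $\mathcal P_x[p](\rho)=(1-p)\rho+pX\rho X$. **Theorem.** Suppose that every $\mathcal N_{\mathcal L}$ has pure $Z$-coherence, i.e. $[\mathcal N_{\mathcal L}]_{P,XP}=[\mathcal N_{\mathcal L}]_{P,YP}=0$ for all $P\in\{I,X,Y,Z\}$ and $[\mathcal N_{\mathcal L}]_{Z,Z}=1$. For each physical qubit $\gamma$ let $x_\gamma$ be the $(X,X)$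 entry of the product of the $W_\gamma$ Pauli transfer matrices of the channels on $\gamma$, and let $q_\gamma=(1-x_\gamma)/2$. Then $q_\gamma\in[0,1]$, and $\{\mathcal N_{\mathcal L}\}$ is equivalent on the foliated code to 1. the single-qubit Pauli channels $\mathcal F_{\mathcal L}=\mathcal P_z[p_{\mathcal L}]$ at the same locations of the same circuit, with $p_{\mathcal L}=\tfrac12\bigl(1-\sqrt[W_\gamma]{x_\gamma}\bigr)$ for every location $\mathcal L$ on $\gamma$ (if $x_\gamma<0$ and $W_\gamma$ is even, the root is replaced by $\sqrt[W_\gamma]{|x_\gamma|}$, with a minus sign at the location after the preparation of $\gamma$); 2. incoherent flips of the code: $\mathcal E_\sigma[\{\mathcal N_{\mathcal L}\}](\rho)$ equals the result of $2L$ steps in which, at step $t$, each code qubit $i$ undergoes the bit flip $\mathcal P_x[q_{(i,t)}]$ ($t$ odd) or the phase flip $\mathcal P_z[q_{(i,t)}]$ ($t$ even), and then the $X$-type ($t$ odd) or $Z$-type ($t$ even) generators are measured projectively, each outcome being flipped independently with probability $q_{(a,t)}$, with reported outcomes $s'_{a,t}=\sigma_{a,t}+\sigma_{a,t-2}+\sigma_{a,t-4}+\cdots$.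 For each $\gamma$, the channels $\mathcal F_{\mathcal L}$ are obtained from one entry of a matrix that is computed with $W_\gamma-1$ multiplications of $4\times4$ matrices, in an order that does not depend on the channels or on the order of the CZ gates; and $W_\gamma\le\max(w+1,\,d+3)$, where $w$ is the largest weight of a generator and $d$ the largest number of generators of one type ($X$ or $Z$) acting on one qubit. -/

import Mathlib

namespace Foliation

/-! ### Single-qubit operators and channels -/

/-- Bits: measurement outcomes and labels of computational basis states. -/
abbrev Bit := ZMod 2

/-- The sign `(-1)^x`. -/
def sgn (x : Bit) : ℂ := if x = 0 then 1 else -1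

/-- Operators on one qubit. -/
abbrev Op1 := Matrix Bit Bit ℂ

/-- Linear maps on the operators of one qubit. -/
abbrev SuperOp1 := Op1 →ₗ[ℂ] Op1

/-- Labels of the single-qubit Pauli operators. -/
inductive Pauli
  | I | X | Y | Z
  deriving DecidableEq

instance : Fintype Pauli :=
  ⟨{.I, .X, .Y, .Z}, fun P => by cases P <;> decide⟩

/-- The Pauli matrices, in the basis `|0⟩, |1⟩`. -/
def Pauli.mat : Pauli → Op1
  | .I => 1
  | .X => Matrix.of fun a b => if a = b then 0 else 1
  | .Y => Matrix.of fun a b => if a = b then 0 else if a = 0 then -Complex.I else Complex.I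
  | .Z => Matrix.diagonal sgn

/-- The map `ρ ↦ A ρ A†`. -/
def conjBy (A : Op1) : SuperOp1 :=
  LinearMap.mulLeft ℂ A ∘ₗ LinearMap.mulRight ℂ A.conjTranspose

/-- Quantum channels: `ρ ↦ ∑ₖ Eₖ ρ Eₖ†` with `∑ₖ Eₖ† Eₖ = 1`. -/
def IsChannel (N : SuperOp1) : Prop :=
  ∃ (r : ℕ) (E : Fin r → Op1),
    ∑ k, (E k).conjTranspose * E k = 1 ∧ N = ∑ k, conjBy (E k)

/-- Pauli error channels: `ρ ↦ ∑_P p_P P ρ P†` for a probability distribution `p`. -/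
def IsPauliChannel (N : SuperOp1) : Prop :=
  ∃ p : Pauli → ℝ, (∀ P, 0 ≤ p P) ∧ ∑ P, p P = 1 ∧ N = ∑ P, (p P : ℂ) • conjBy P.mat

/-- `[N]_{A,B} = Tr[A† N(B)] / 2`, also for `A`, `B` that are Pauli operators times a phase. -/
noncomputable def ptmEntry (N : SuperOp1) (A B : Op1) : ℂ :=
  (A.conjTranspose * N B).trace / 2

/-- The `4 × 4` Pauli transfer matrix. -/
noncomputable def ptm (N : SuperOp1) : Matrix Pauli Pauli ℂ :=
  Matrix.of fun P P' => ptmEntry N P.mat P'.mat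

/-- Pure `Z`-coherence: `[N]_{P,XP} = [N]_{P,YP} = 0` for every Pauli `P`, and `[N]_{Z,Z} = 1`. -/
def PureZ (N : SuperOp1) : Prop :=
  (∀ P : Pauli, ptmEntry N P.mat (Pauli.X.mat * P.mat) = 0 ∧
    ptmEntry N P.mat (Pauli.Y.mat * P.mat) = 0) ∧
  ptmEntry N Pauli.Z.mat Pauli.Z.mat = 1

/-- The phase flip channel `ρ ↦ (1 - p) ρ + p Z ρ Z`. -/
noncomputable def phaseFlip (p : ℝ) : SuperOp1 :=
  ((1 - p : ℝ) : ℂ) • LinearMap.id + (p : ℂ) • conjBy Pauli.Z.mat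

/-! ### Multi-qubit operators -/

/-- Operators on the qubits labelled by `Q`, in the computational basis. -/
abbrev Op (Q : Type) := Matrix (Q → Bit) (Q → Bit) ℂ

/-- The two kinds of stabilizers of a CSS code. -/
inductive Kind
  | X | Z
  deriving DecidableEq

instance : Fintype Kind :=
  ⟨{.X, .Z}, fun b => by cases b <;> decide⟩

/-- The tensor products `∏ᵢ Xᵢ^{e i}` and `∏ᵢ Zᵢ^{e i}`. -/
def pauliOp {Q : Type} [Fintype Q] [DecidableEq Q] : Kind → (Q → Bit) → Op Q
  | .X, e => Matrix.of fun a b => if a = b + e then 1 else 0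
  | .Z, e => Matrix.diagonal fun a => sgn (∑ i, e i * a i)

/-- The map `Λ ⊗ id`, with the single-qubit map `Λ` acting on the qubit `v`. -/
noncomputable def onQubit {Q : Type} [DecidableEq Q] (v : Q) (Λ : SuperOp1) (ρ : Op Q) : Op Q :=
  Matrix.of fun a b => ∑ x : Bit, ∑ y : Bit,
    Λ (Matrix.single x y 1) (a v) (b v) * ρ (Function.update a v x) (Function.update b v y)

/-- Conjugation by the gate `CZ` on the qubits `u` and `v`. -/
def applyCZ {Q : Type} (u v : Q) (ρ : Op Q) : Op Q :=
  Matrix.of fun a b => sgn (a u * a v) * ρ a b * sgn (b u * b v)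

/-- The elementary steps of a circuit between state preparation and measurement. -/
inductive Instr (Q : Type)
  | cz (u v : Q)
  | noise (v : Q) (Λ : SuperOp1)

/-- The action of a single step. -/
noncomputable def Instr.apply {Q : Type} [DecidableEq Q] : Instr Q → Op Q → Op Q
  | .cz u v, ρ => applyCZ u v ρ
  | .noise v Λ, ρ => onQubit v Λ ρ

/-- Run a circuit; the head of the list acts first. -/
noncomputable def runCircuit {Q : Type} [DecidableEq Q] (c : List (Instr Q)) (ρ : Op Q) : Op Q :=
  c.foldl (fun ρ g => g.apply ρ) ρ

/-! ### CSS codes -/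

/-- A CSS code on `n` qubits, given by the supports of its `X` and `Z` stabilizer generators.
The generators need not be independent. -/
structure CSSCode (n : ℕ) where
  /-- the number of generators of each kind -/
  num : Kind → ℕ
  /-- the supports of the generators -/
  supp : (b : Kind) → Fin (num b) → Finset (Fin n)
  /-- `X` and `Z` generators commute -/
  comm : ∀ p q, Even (supp .X p ∩ supp .Z q).card

variable {n : ℕ}

/-- The stabilizer generators as operators. -/
def CSSCode.stab (C : CSSCode n) (b : Kind) (a : Fin (C.num b)) : Op (Fin n) :=
  pauliOp b fun i => if i ∈ C.supp b a then 1 else 0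

/-- Operators supported on the code space (for a density operator: code states). -/
def CSSCode.IsCodeOp (C : CSSCode n) (ρ : Op (Fin n)) : Prop :=
  ∀ b a, C.stab b a * ρ = ρ ∧ ρ * C.stab b a = ρ

/-- The number of generators of kind `b` that act on the qubit `i`. -/
def CSSCode.degree (C : CSSCode n) (b : Kind) (i : Fin n) : ℕ :=
  (Finset.univ.filter fun a => i ∈ C.supp b a).card

/-- The largest weight of a generator. -/
def CSSCode.maxWeight (C : CSSCode n) : ℕ :=
  Finset.univ.sup fun b => Finset.univ.sup fun a => (C.supp b a).card

/-- The largest number of generators of one kind that act on one qubit. -/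
def CSSCode.maxDegree (C : CSSCode n) : ℕ :=
  Finset.univ.sup fun b => Finset.univ.sup fun i => C.degree b i

/-! ### Space-time locations

Each of the `L` rounds `k = 0, …, L - 1` of syndrome extraction consists of a layer `(k, X)`
followed by a layer `(k, Z)`; the layer `(k, X)` is time `t = 2k + 1` and the layer `(k, Z)` is
time `t = 2k + 2` of the foliation. In each layer every code qubit is teleported to a fresh
physical qubit, and the generators of the kind of the layer are measured. -/

/-- The locations of single-qubit noise: after each preparation, and on each of the two qubits
after each `CZ` gate. -/
inductive Loc (C : CSSCode n)
  /-- the physical qubit of code qubit `i` in layer `(k, b)`, after its preparation -/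
  | codePrep (k : ℕ) (b : Kind) (i : Fin n)
  /-- the same qubit, after the gate with its predecessor in the teleportation chain -/
  | codeIn (k : ℕ) (b : Kind) (i : Fin n)
  /-- the same qubit, after the gate with the ancilla of the generator `a` -/
  | codeStab (k : ℕ) (b : Kind) (a : Fin (C.num b)) (i : Fin n)
  /-- the same qubit, after the gate with its successor in the teleportation chain -/
  | codeOut (k : ℕ) (b : Kind) (i : Fin n)
  /-- the ancilla of the generator `a`, after its preparation -/
  | ancPrep (k : ℕ) (b : Kind) (a : Fin (C.num b))
  /-- the same ancilla, after the gate with code qubit `i` -/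
  | ancStab (k : ℕ) (b : Kind) (a : Fin (C.num b)) (i : Fin n)

/-- The physical qubits: one for each code qubit and layer, one for each generator and round. -/
inductive Site (C : CSSCode n)
  | code (k : ℕ) (b : Kind) (i : Fin n)
  | anc (k : ℕ) (b : Kind) (a : Fin (C.num b))

/-- The round to which a physical qubit belongs. -/
def Site.round {C : CSSCode n} : Site C → ℕ
  | .code k _ _ => k
  | .anc k _ _ => k

/-- The physical qubit at which a location lies. -/
def Loc.site {C : CSSCode n} : Loc C → Site C
  | .codePrep k b i => .code k b i
  | .codeIn k b i => .code k b i
  | .codeStab k b _ i => .code k b i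
  | .codeOut k b i => .code k b i
  | .ancPrep k b a => .anc k b a
  | .ancStab k b a _ => .anc k b a

/-- Whether the location directly follows the preparation of its qubit. -/
def Loc.isPrep {C : CSSCode n} : Loc C → Prop
  | .codePrep _ _ _ => True
  | .ancPrep _ _ _ => True
  | _ => False

/-- All the locations on a physical qubit in a foliation with `L` rounds. The code qubits of the
last layer have no successor. -/
def Site.locs {C : CSSCode n} (L : ℕ) : Site C → List (Loc C)
  | .code k b i =>
      [.codePrep k b i, .codeIn k b i] ++
      ((List.finRange (C.num b)).filter fun a => i ∈ C.supp b a).map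
        (fun a => .codeStab k b a i) ++
      (if b = .Z ∧ k + 1 = L then [] else [.codeOut k b i])
  | .anc k b a =>
      .ancPrep k b a ::
      ((List.finRange n).filter fun i => i ∈ C.supp b a).map (fun i => .ancStab k b a i)

/-- The number `W` of locations on a physical qubit. -/
def Site.W {C : CSSCode n} (L : ℕ) (γ : Site C) : ℕ := (γ.locs L).length

/-- The locations that occur in the foliation with `L` rounds. -/
def Loc.Occurs {C : CSSCode n} (L : ℕ) (l : Loc C) : Prop :=
  l.site.round < L ∧ l ∈ l.site.locs L

/-! ### The foliation circuit -/

/-- An order of the `CZ` gates between ancillas and code qubits in each layer: every pair of a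
generator and a qubit in its support, exactly once. -/
structure Schedule (C : CSSCode n) (L : ℕ) where
  /-- the sequence of gates of each layer -/
  seq : Fin L → (b : Kind) → List (Fin (C.num b) × Fin n)
  nodup : ∀ k b, (seq k b).Nodup
  mem_iff : ∀ k b x, x ∈ seq k b ↔ x.2 ∈ C.supp b x.1

/-- The physical qubits that are present in one layer: the `n` old qubits of the chains, the `n`
fresh ones, and the ancillas. -/
abbrev Wire (n r : ℕ) := Fin n ⊕ Fin n ⊕ Fin r

/-- An old qubit. -/
abbrev Wire.old {n r : ℕ} (i : Fin n) : Wire n r := Sum.inl i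

/-- A fresh qubit. -/
abbrev Wire.new {n r : ℕ} (i : Fin n) : Wire n r := Sum.inr (Sum.inl i)

/-- An ancilla. -/
abbrev Wire.anc {n r : ℕ} (a : Fin r) : Wire n r := Sum.inr (Sum.inr a)

/-- The state `ρ ⊗ |+⟩⟨+| ⊗ ⋯ ⊗ |+⟩⟨+|`, with `ρ` on the old qubits. -/
noncomputable def prepare {n r : ℕ} (ρ : Op (Fin n)) : Op (Wire n r) :=
  Matrix.of fun a b => ρ (fun i => a (.old i)) (fun i => b (.old i)) * (1 / 2) ^ (n + r)

/-- The measurement of all old qubits and all ancillas in the `X` basis, with outcomes `m` and `s`;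
the result is the unnormalized state of the fresh qubits. Here `⟨m_X|x⟩ = (-1)^{m x} / √2`. -/
noncomputable def measureX {n r : ℕ} (m : Fin n → Bit) (s : Fin r → Bit) (ρ : Op (Wire n r)) :
    Op (Fin n) :=
  Matrix.of fun x y => ∑ u : Fin n → Bit, ∑ v : Fin n → Bit, ∑ c : Fin r → Bit, ∑ d : Fin r → Bit,
    (∏ i, sgn (m i * u i) * sgn (m i * v i) / 2) * (∏ a, sgn (s a * c a) * sgn (s a * d a) / 2) *
      ρ (Sum.elim u (Sum.elim x c)) (Sum.elim v (Sum.elim y d))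

/-- The noise on the old qubit of chain `i` after its gate with the fresh qubit of layer `(k, b)`.
The input qubits of the whole foliation carry no noise. -/
def outNoise {C : CSSCode n} (N : Loc C → SuperOp1) (k : ℕ) : Kind → Fin n → SuperOp1
  | .X, i => if k = 0 then LinearMap.id else N (.codeOut (k - 1) .Z i)
  | .Z, i => N (.codeOut k .X i)

/-- The circuit of the layer `(k, b)` between preparation and measurement: the teleportation gates,
then the gates between ancillas and fresh qubits, with noise after each preparation and gate. -/
def layerCircuit {C : CSSCode n} {L : ℕ} (S : Schedule C L) (N : Loc C → SuperOp1) (k : Fin L)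
    (b : Kind) : List (Instr (Wire n (C.num b))) :=
  (List.finRange n).map (fun i => .noise (.new i) (N (.codePrep k b i))) ++
  (List.finRange (C.num b)).map (fun a => .noise (.anc a) (N (.ancPrep k b a))) ++
  (List.finRange n).flatMap (fun i =>
    [.cz (.old i) (.new i),
     .noise (.old i) (outNoise N k b i),
     .noise (.new i) (N (.codeIn k b i))]) ++
  (S.seq k b).flatMap (fun x =>
    [.cz (.anc x.1) (.new x.2),
     .noise (.anc x.1) (N (.ancStab k b x.1 x.2)),
     .noise (.new x.2) (N (.codeStab k b x.1 x.2))])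

/-- One layer, for given outcomes `m` of the teleportations and `s` of the ancillas. -/
noncomputable def layer {C : CSSCode n} {L : ℕ} (S : Schedule C L) (N : Loc C → SuperOp1)
    (k : Fin L) (b : Kind) (m : Fin n → Bit) (s : Fin (C.num b) → Bit) (ρ : Op (Fin n)) :
    Op (Fin n) :=
  measureX m s (runCircuit (layerCircuit S N k b) (prepare ρ))

/-- The outcomes of the teleportations in all layers. -/
abbrev TeleOutcomes (n L : ℕ) := Fin L → Kind → Fin n → Bit

/-- One bit for each generator and round. -/
abbrev StabOutcomes (C : CSSCode n) (L : ℕ) := Fin L → (b : Kind) → Fin (C.num b) → Bit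

/-- The unnormalized state after `L` rounds, for given outcomes of all measurements. -/
noncomputable def foliate {C : CSSCode n} {L : ℕ} (S : Schedule C L) (N : Loc C → SuperOp1)
    (m : TeleOutcomes n L) (s : StabOutcomes C L) (ρ : Op (Fin n)) : Op (Fin n) :=
  (List.finRange L).foldl
    (fun ρ k => layer S N k .Z (m k .Z) (s k .Z) (layer S N k .X (m k .X) (s k .X) ρ)) ρ

/-- The Pauli frame `X^{m₂ + m₄ + ⋯} Z^{m₁ + m₃ + ⋯}` on each code qubit after all layers. -/
def pauliFrame {L : ℕ} (m : TeleOutcomes n L) : Op (Fin n) :=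
  pauliOp .X (fun i => ∑ k, m k .Z i) * pauliOp .Z (fun i => ∑ k, m k .X i)

/-- The outcomes `s_t + s_{t-2} + u_t(m_t)` of the cluster state stabilizers, where `u_t(m_t)` is
the parity of `m_t` on the support of the generator, and `s_{t-2}` is absent in the first round. -/
def clusterSyndrome {C : CSSCode n} {L : ℕ} (m : TeleOutcomes n L) (s : StabOutcomes C L) :
    StabOutcomes C L :=
  fun k b a => s k b a + (if 0 < k.val then s ⟨k.val - 1, by omega⟩ b a else 0) +
    ∑ i ∈ C.supp b a, m k b i

/-- The output of the noisy foliation after the Pauli frame update, for given outcomes `σ` of the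
cluster state stabilizers, averaged over everything else. Its trace is the probability of `σ`. -/
noncomputable def foliationOutput {C : CSSCode n} {L : ℕ} (S : Schedule C L)
    (N : Loc C → SuperOp1) (σ : StabOutcomes C L) (ρ : Op (Fin n)) : Op (Fin n) :=
  ∑ m : TeleOutcomes n L, ∑ s : StabOutcomes C L,
    if clusterSyndrome m s = σ then
      (pauliFrame m).conjTranspose * foliate S N m s ρ * pauliFrame m
    else 0

/-! ### The code under independent flips

Ordinary syndrome extraction on the code: in each layer first the code qubits are flipped
independently, then the generators are measured projectively and the outcomes flipped. -/

/-- The probability of the pattern `e` of independent flips with probabilities `q`. -/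
noncomputable def flipWeight {r : ℕ} (q : Fin r → ℝ) (e : Fin r → Bit) : ℝ :=
  ∏ i, if e i = 0 then 1 - q i else q i

/-- Bit flip channels (`b = X`) or phase flip channels (`b = Z`) with probability `q i` on each
code qubit `i`. -/
noncomputable def flipNoise (b : Kind) (q : Fin n → ℝ) (ρ : Op (Fin n)) : Op (Fin n) :=
  ∑ e : Fin n → Bit, (flipWeight q e : ℂ) • (pauliOp b e * ρ * (pauliOp b e).conjTranspose)

/-- The product of the projectors `(1 + (-1)^{s a} S_a) / 2` over the generators of kind `b`. -/
noncomputable def CSSCode.projector (C : CSSCode n) (b : Kind) (s : Fin (C.num b) → Bit) :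
    Op (Fin n) :=
  (List.ofFn fun a => (1 / 2 : ℂ) • (1 + sgn (s a) • C.stab b a)).prod

/-- The measurement of the generators of kind `b` with reported outcomes `s`, each of which is
flipped with probability `q a`. -/
noncomputable def CSSCode.flippedMeasurement (C : CSSCode n) (b : Kind) (q : Fin (C.num b) → ℝ)
    (s : Fin (C.num b) → Bit) (ρ : Op (Fin n)) : Op (Fin n) :=
  ∑ f : Fin (C.num b) → Bit, (flipWeight q f : ℂ) •
    (C.projector b (s + f) * ρ * (C.projector b (s + f)).conjTranspose)

/-- The generator outcomes in the Pauli frame, of which the cluster state stabilizers are the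
differences between consecutive rounds. -/
def frameSyndrome {C : CSSCode n} {L : ℕ} (σ : StabOutcomes C L) : StabOutcomes C L :=
  fun k b a => ∑ j ∈ Finset.Iic k, σ j b a

/-- `L` rounds of syndrome extraction where the flip probability at each code qubit and layer, and
at each measurement, is `q γ`. -/
noncomputable def flipModelOutput (C : CSSCode n) {L : ℕ} (q : Site C → ℝ) (σ : StabOutcomes C L)
    (ρ : Op (Fin n)) : Op (Fin n) :=
  let half (k : Fin L) (b : Kind) (ρ : Op (Fin n)) : Op (Fin n) :=
    C.flippedMeasurement b (fun a => q (.anc k b a)) (frameSyndrome σ k b)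
      (flipNoise b (fun i => q (.code k b i)) ρ)
  (List.finRange L).foldl (fun ρ k => half k .Z (half k .X ρ)) ρ

/-! ### Computing the Pauli channels -/

/-- Programs that multiply `4 × 4` matrices, with the inputs labelled by `ι`. -/
inductive MulProg (ι : Type)
  | input (l : ι)
  | mul (e f : MulProg ι)

namespace MulProg

/-- The result of a program. -/
noncomputable def eval {ι : Type} (v : ι → Matrix Pauli Pauli ℂ) :
    MulProg ι → Matrix Pauli Pauli ℂ
  | .input l => v l
  | .mul e f => e.eval v * f.eval v

/-- The number of matrix multiplications that a program performs. -/
def mults {ι : Type} : MulProg ι → ℕ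
  | .input _ => 0
  | .mul e f => e.mults + f.mults + 1

/-- The inputs that a program reads. -/
def inputs {ι : Type} : MulProg ι → List ι
  | .input l => [l]
  | .mul e f => e.inputs ++ f.inputs

end MulProg

/-- The entry `x = [N_γ]_{X,X}` of the computed Pauli transfer matrix of the combined error `N_γ`
on the physical qubit `γ`. -/
noncomputable def xEntry {C : CSSCode n} (prog : Site C → MulProg (Loc C)) (N : Loc C → SuperOp1)
    (γ : Site C) : ℝ :=
  ((prog γ).eval (fun l => ptm (N l)) .X .X).re

/-- The total flip probability `(1 - x) / 2` on the physical qubit `γ`. For a combined error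
`ρ ↦ A ρ A†` with `A = α + β Z` it is `|β|²`. -/
noncomputable def totalFlip {C : CSSCode n} (prog : Site C → MulProg (Loc C))
    (N : Loc C → SuperOp1) (γ : Site C) : ℝ :=
  (1 - xEntry prog N γ) / 2

open Classical in
/-- The flip probability `(1 - x^{1/W}) / 2` at a single location. For odd `W` the root is the real
one; for even `W` and `x < 0`, where there is no real root, the root of `|x|` is used, with the sign
reversed at the location that follows the preparation. -/
noncomputable def locFlip {C : CSSCode n} (L : ℕ) (prog : Site C → MulProg (Loc C))
    (N : Loc C → SuperOp1) (l : Loc C) : ℝ :=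
  let x := xEntry prog N l.site
  let r := |x| ^ ((1 : ℝ) / (l.site.W L : ℝ))
  if x < 0 ∧ (Odd (l.site.W L) ∨ l.isPrep) then (1 + r) / 2 else (1 - r) / 2

/-- The Pauli channels that replace the channels `N`: phase flips on the physical qubits. On a code
qubit in an odd layer this is a bit flip of the code, since the teleportations have applied an odd
number of Hadamard gates; on an ancilla it flips the outcome of the `X` measurement. -/
noncomputable def pauliReplacement {C : CSSCode n} (L : ℕ) (prog : Site C → MulProg (Loc C))
    (N : Loc C → SuperOp1) (l : Loc C) : SuperOp1 :=
  phaseFlip (locFlip L prog N l)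

end Foliation

namespace Foliation

/-! ### Signs and binary vectors -/

/-! For a channel, the entry `[N]_{Z,Z} = 1` forces diagonal Kraus operators. In the computational
basis such noise multiplies each matrix entry by a factor `f x y` that is `1` on the diagonal and
has `f 0 1 = μ`, `f 1 0 = conj μ`, `‖μ‖ ≤ 1` (`isDephasing_of_channel`). The CZ gates also act by
entrywise multiplication. Hence everything between preparation and measurement commutes, the order
of the gates is irrelevant, and all noise on one physical qubit merges into a single factor
`siteFactor`. A layer is then a Hadamard gate on every qubit, a bit flip by the teleportation
outcomes, and one entrywise multiplication (`layer_apply`).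

Coherence is removed by two different twirls. On code qubits it is the randomness of the
teleportation: the outcomes `m` are in bijection with the Pauli frames `g` after each layer, of
which they are the consecutive sums mod 2. Once `g` and `σ` are given, the ancilla outcomes are
determined (`clusterSyndrome_eq_iff`), so fixing `σ` leaves `g` free. In the frame each component of
`g` enters only the code-qubit factors of its own layer (`foliate_frame`). The sum over `g`
therefore splits layer by layer and qubit by qubit, and averages `μ` with `conj μ`, leaving `Re μ`:
the factor of a phase flip.

On ancillas it is the code: a state invariant under conjugation by the stabilizers has, after the
Hadamard gates of a layer, no entry between different syndromes (`hadConj_apply_eq_zero`). Only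
equal outcomes on the two sides of `ρ` contribute, and for these the readout is a classical flip
with probability `(1 - Re μ) / 2` (`IsDephFactor.readout_self`). Since `X` and `Z` generators
commute, the invariance passes from layer to layer (`StabInvariant.flipStep`).

So the output depends on the noise only through `Re μ` on each physical qubit and is that of the
flip model (`foliationOutput_eq_flipModelOutput`). Transfer matrices of dephasing channels multiply
like the numbers `μ`, so `Re μ` is the `(X,X)` entry of their product. The `W`-th root spreads this
value over the locations (`prod_locFlip`), and the Pauli channels lead to the same flip model. -/

theorem Bit.eq_zero_or_one (x : Bit) : x = 0 ∨ x = 1 := by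
  revert x; decide

theorem Bit.add_self (x : Bit) : x + x = 0 := CharTwo.add_self_eq_zero x

@[simp] theorem sgn_zero : sgn 0 = 1 := by simp [sgn]

@[simp] theorem sgn_one : sgn 1 = -1 := by simp [sgn]

theorem sgn_add (x y : Bit) : sgn (x + y) = sgn x * sgn y := by
  rcases x.eq_zero_or_one with rfl | rfl <;> rcases y.eq_zero_or_one with rfl | rfl <;>
    simp [CharTwo.add_self_eq_zero]

@[simp] theorem sgn_mul_self (x : Bit) : sgn x * sgn x = 1 := by
  rw [← sgn_add, Bit.add_self, sgn_zero]

@[simp] theorem star_sgn (x : Bit) : star (sgn x) = sgn x := by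
  rcases x.eq_zero_or_one with rfl | rfl <;> simp

theorem sgn_sum {ι : Type*} (s : Finset ι) (f : ι → Bit) :
    sgn (∑ i ∈ s, f i) = ∏ i ∈ s, sgn (f i) := by
  classical
  induction s using Finset.induction_on with
  | empty => simp
  | insert a s ha ih => rw [Finset.sum_insert ha, Finset.prod_insert ha, sgn_add, ih]

theorem sgn_dotProduct {ι : Type*} [Fintype ι] (x y : ι → Bit) :
    sgn (x ⬝ᵥ y) = ∏ i, sgn (x i * y i) := sgn_sum _ _

theorem sum_bit {M : Type*} [AddCommMonoid M] (f : Bit → M) : ∑ x, f x = f 0 + f 1 :=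
  Fin.sum_univ_two f

theorem prod_sum_pi {ι κ : Type*} [Fintype ι] [DecidableEq ι] [Fintype κ] (f : ι → κ → ℂ) :
    ∏ i, ∑ c, f i c = ∑ u : ι → κ, ∏ i, f i (u i) := by
  classical
  rw [Finset.prod_univ_sum, Fintype.piFinset_univ]

theorem sum_sgn_dotProduct {ι : Type*} [Fintype ι] [DecidableEq ι] (z : ι → Bit) :
    ∑ u : ι → Bit, sgn (z ⬝ᵥ u) = if z = 0 then 2 ^ Fintype.card ι else 0 := by
  have h : ∑ u : ι → Bit, sgn (z ⬝ᵥ u) = ∏ i, ∑ c, sgn (z i * c) := by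
    rw [prod_sum_pi]; simp only [sgn_dotProduct]
  rw [h]
  split_ifs with hz
  · subst hz; simp
  · obtain ⟨i, hi⟩ := Function.ne_iff.1 hz
    apply Finset.prod_eq_zero (Finset.mem_univ i)
    rw [sum_bit]
    rcases (z i).eq_zero_or_one with h0 | h1
    · exact absurd h0 hi
    · simp [h1]

theorem Bit.add_eq_zero_iff {ι : Type*} (x y : ι → Bit) : x + y = 0 ↔ x = y := by
  simp only [funext_iff, Pi.add_apply, Pi.zero_apply, CharTwo.add_eq_zero]

theorem vec_add_self {ι : Type*} (x : ι → Bit) : x + x = 0 := (Bit.add_eq_zero_iff x x).2 rfl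

theorem vec_add_add_cancel {ι : Type*} (x y : ι → Bit) : x + y + y = x := by
  rw [add_assoc, vec_add_self, add_zero]

/-! ### Hadamard gates and Pauli frames -/

variable {n : ℕ}

/-- The unnormalized Hadamard transform on `n` qubits. -/
def walsh (n : ℕ) : Op (Fin n) := Matrix.of fun x u => sgn (x ⬝ᵥ u)

theorem walsh_mul_walsh (n : ℕ) : walsh n * walsh n = (2 : ℂ) ^ n • 1 := by
  ext x y
  have h : ∀ u, sgn (x ⬝ᵥ u) * sgn (u ⬝ᵥ y) = sgn ((x + y) ⬝ᵥ u) := fun u => by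
    rw [add_dotProduct, sgn_add, dotProduct_comm u y]
  simp only [Matrix.mul_apply, walsh, Matrix.of_apply, h, sum_sgn_dotProduct, Bit.add_eq_zero_iff,
    Fintype.card_fin, Matrix.smul_apply, Matrix.one_apply, smul_eq_mul, mul_ite, mul_one, mul_zero]

theorem walsh_conjTranspose (n : ℕ) : (walsh n).conjTranspose = walsh n := by
  ext x y
  simp only [Matrix.conjTranspose_apply, walsh, Matrix.of_apply, star_sgn, dotProduct_comm x y]

/-- Conjugation by a Hadamard gate on every qubit. -/
noncomputable def hadConj : Op (Fin n) →ₗ[ℂ] Op (Fin n) :=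
  (1 / 2 : ℂ) ^ n • (LinearMap.mulLeft ℂ (walsh n) ∘ₗ LinearMap.mulRight ℂ (walsh n))

theorem hadConj_eq (ρ : Op (Fin n)) :
    hadConj ρ = (1 / 2 : ℂ) ^ n • (walsh n * (ρ * walsh n)) := rfl

theorem half_pow_mul_two_pow (n : ℕ) : (1 / 2 : ℂ) ^ n * 2 ^ n = 1 := by
  rw [← mul_pow]; norm_num

theorem hadConj_mul (A B : Op (Fin n)) : hadConj (A * B) = hadConj A * hadConj B := by
  have h : walsh n * (A * walsh n) * (walsh n * (B * walsh n)) =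
      (2 : ℂ) ^ n • (walsh n * (A * B * walsh n)) := by
    calc _ = walsh n * A * (walsh n * walsh n) * B * walsh n := by simp only [Matrix.mul_assoc]
      _ = _ := by rw [walsh_mul_walsh]; simp [Matrix.mul_assoc]
  rw [hadConj_eq, hadConj_eq, hadConj_eq, Matrix.smul_mul, Matrix.mul_smul, h, smul_smul, smul_smul,
    mul_assoc ((1 / 2 : ℂ) ^ n), half_pow_mul_two_pow, mul_one]

theorem hadConj_one : hadConj (1 : Op (Fin n)) = 1 := by
  rw [hadConj_eq, one_mul, walsh_mul_walsh, smul_smul, half_pow_mul_two_pow, one_smul]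

theorem hadConj_hadConj (ρ : Op (Fin n)) : hadConj (hadConj ρ) = ρ := by
  have h : walsh n * (walsh n * (ρ * walsh n) * walsh n) = (2 : ℂ) ^ n • (2 : ℂ) ^ n • ρ := by
    calc _ = (walsh n * walsh n) * ρ * (walsh n * walsh n) := by simp only [Matrix.mul_assoc]
      _ = _ := by rw [walsh_mul_walsh]; simp
  rw [hadConj_eq, hadConj_eq, Matrix.smul_mul, Matrix.mul_smul, h, smul_smul, smul_smul, smul_smul]
  rw [show (1 / 2 : ℂ) ^ n * (1 / 2) ^ n * 2 ^ n * 2 ^ n =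
    ((1 / 2 : ℂ) ^ n * 2 ^ n) * ((1 / 2) ^ n * 2 ^ n) by ring,
    half_pow_mul_two_pow, one_mul, one_smul]

theorem hadConj_conjTranspose (ρ : Op (Fin n)) :
    hadConj ρ.conjTranspose = (hadConj ρ).conjTranspose := by
  simp [hadConj_eq, Matrix.conjTranspose_mul, walsh_conjTranspose, Matrix.mul_assoc]

theorem hadConj_apply (ρ : Op (Fin n)) (x y : Fin n → Bit) :
    hadConj ρ x y = (1 / 2) ^ n * ∑ u, ∑ v, sgn (x ⬝ᵥ u) * sgn (y ⬝ᵥ v) * ρ u v := by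
  simp only [hadConj_eq, Matrix.smul_apply, Matrix.mul_apply, walsh, Matrix.of_apply, smul_eq_mul,
    Finset.mul_sum, dotProduct_comm _ y]
  refine Finset.sum_congr rfl fun u _ => Finset.sum_congr rfl fun v _ => by ring

/-- Conjugation by the Pauli operator `∏ᵢ Xᵢ^{f i} Zᵢ^{g i}`. -/
def frameConj (f g : Fin n → Bit) (ρ : Op (Fin n)) : Op (Fin n) :=
  Matrix.of fun x y => sgn (g ⬝ᵥ (x + y)) * ρ (x + f) (y + f)

theorem frameConj_zero (ρ : Op (Fin n)) : frameConj 0 0 ρ = ρ := by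
  ext x y; simp [frameConj]

/-- Hadamard gates exchange `X` and `Z`. The signs from reordering the two Pauli parts occur on both
sides of `ρ` and cancel. -/
theorem hadConj_frameConj (f g : Fin n → Bit) (ρ : Op (Fin n)) :
    hadConj (frameConj f g ρ) = frameConj g f (hadConj ρ) := by
  ext x y
  simp only [hadConj_apply, frameConj, Matrix.of_apply]
  rw [← Equiv.sum_comp (Equiv.addRight f), mul_left_comm]
  congr 1
  rw [Finset.mul_sum]
  refine Finset.sum_congr rfl fun u _ => ?_
  rw [← Equiv.sum_comp (Equiv.addRight f), Finset.mul_sum]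
  refine Finset.sum_congr rfl fun v _ => ?_
  have h : u + f + (v + f) = u + v := by
    rw [add_add_add_comm, vec_add_self, add_zero]
  simp only [Equiv.coe_addRight, vec_add_add_cancel, h, dotProduct_add, add_dotProduct, sgn_add,
    dotProduct_comm g, dotProduct_comm f]
  ring

theorem pauliOp_X_apply (e : Fin n → Bit) (a b : Fin n → Bit) :
    pauliOp .X e a b = if a = b + e then 1 else 0 := rfl

theorem pauliOp_Z_apply (e : Fin n → Bit) (a b : Fin n → Bit) :
    pauliOp .Z e a b = if a = b then sgn (e ⬝ᵥ a) else 0 := by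
  simp [pauliOp, Matrix.diagonal_apply, dotProduct]

theorem eq_add_iff (a b e : Fin n → Bit) : a = b + e ↔ b = a + e :=
  ⟨fun h => by rw [h, vec_add_add_cancel], fun h => by rw [h, vec_add_add_cancel]⟩

theorem pauliOp_conjTranspose (b : Kind) (e : Fin n → Bit) :
    (pauliOp b e).conjTranspose = pauliOp b e := by
  ext x y
  cases b
  · simp only [Matrix.conjTranspose_apply, pauliOp_X_apply, eq_add_iff x y]
    split_ifs <;> simp
  · simp only [Matrix.conjTranspose_apply, pauliOp_Z_apply]
    by_cases h : x = y
    · subst h; simp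
    · simp [h, Ne.symm h]

theorem pauliOp_X_mul_apply (e : Fin n → Bit) (ρ : Op (Fin n)) (x y : Fin n → Bit) :
    (pauliOp .X e * ρ) x y = ρ (x + e) y := by
  simp [Matrix.mul_apply, pauliOp_X_apply, eq_add_iff x]

theorem mul_pauliOp_X_apply (e : Fin n → Bit) (ρ : Op (Fin n)) (x y : Fin n → Bit) :
    (ρ * pauliOp .X e) x y = ρ x (y + e) := by
  simp [Matrix.mul_apply, pauliOp_X_apply]

theorem pauliOp_Z_mul_apply (e : Fin n → Bit) (ρ : Op (Fin n)) (x y : Fin n → Bit) :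
    (pauliOp .Z e * ρ) x y = sgn (e ⬝ᵥ x) * ρ x y := by
  simp [Matrix.mul_apply, pauliOp_Z_apply]

theorem mul_pauliOp_Z_apply (e : Fin n → Bit) (ρ : Op (Fin n)) (x y : Fin n → Bit) :
    (ρ * pauliOp .Z e) x y = ρ x y * sgn (e ⬝ᵥ y) := by
  simp [Matrix.mul_apply, pauliOp_Z_apply]

theorem frame_undo (f g : Fin n → Bit) (ρ : Op (Fin n)) :
    (pauliOp .X f * pauliOp .Z g).conjTranspose * frameConj f g ρ *
      (pauliOp .X f * pauliOp .Z g) = ρ := by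
  ext x y
  rw [Matrix.conjTranspose_mul, pauliOp_conjTranspose, pauliOp_conjTranspose, ← Matrix.mul_assoc,
    mul_pauliOp_Z_apply, mul_pauliOp_X_apply, Matrix.mul_assoc, pauliOp_Z_mul_apply,
    pauliOp_X_mul_apply]
  have h : x + f + (y + f) = x + y := by
    rw [add_add_add_comm, vec_add_self, add_zero]
  simp only [frameConj, Matrix.of_apply, vec_add_add_cancel, h]
  rw [dotProduct_add, sgn_add]
  linear_combination (sgn (g ⬝ᵥ x) * sgn (g ⬝ᵥ x) * ρ x y) * sgn_mul_self (g ⬝ᵥ y) +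
    ρ x y * sgn_mul_self (g ⬝ᵥ x)

theorem pauliOp_X_conj (e : Fin n → Bit) (ρ : Op (Fin n)) :
    pauliOp .X e * ρ * pauliOp .X e = frameConj e 0 ρ := by
  ext x y
  simp [mul_pauliOp_X_apply, pauliOp_X_mul_apply, frameConj]

theorem pauliOp_Z_conj (e : Fin n → Bit) (ρ : Op (Fin n)) :
    pauliOp .Z e * ρ * pauliOp .Z e = frameConj 0 e ρ := by
  ext x y
  simp only [mul_pauliOp_Z_apply, pauliOp_Z_mul_apply, frameConj, Matrix.of_apply, add_zero,
    dotProduct_add, sgn_add]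
  ring

theorem hadConj_pauliOp_X (e : Fin n → Bit) : hadConj (pauliOp .X e) = pauliOp .Z e := by
  ext x y
  rw [hadConj_apply, pauliOp_Z_apply]
  have h : ∀ u v, sgn (x ⬝ᵥ u) * sgn (y ⬝ᵥ v) * pauliOp .X e u v =
      if u = v + e then sgn (e ⬝ᵥ x) * sgn ((x + y) ⬝ᵥ v) else 0 := fun u v => by
    rw [pauliOp_X_apply]
    split_ifs with h
    · rw [h, dotProduct_add, add_dotProduct, sgn_add, sgn_add, dotProduct_comm e]; ring
    · simp
  simp only [h]
  rw [Finset.sum_comm]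
  simp only [Finset.sum_ite_eq', Finset.mem_univ, if_true, ← Finset.mul_sum, sum_sgn_dotProduct,
    Bit.add_eq_zero_iff, Fintype.card_fin]
  split_ifs
  · linear_combination sgn (e ⬝ᵥ x) * half_pow_mul_two_pow n
  · simp

/-! ### Dephasing channels -/

/-- The factor by which a dephasing map multiplies a matrix entry. -/
def dephFactor (Λ : SuperOp1) (x y : Bit) : ℂ := Λ (Matrix.single x y 1) x y

/-- The factors `f x y` of a dephasing channel: `1` on the diagonal and a complex number of modulus
at most `1` and its conjugate off the diagonal. -/
structure IsDephFactor (f : Bit → Bit → ℂ) : Prop where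
  diag : ∀ x, f x x = 1
  conj : ∀ x y, star (f x y) = f y x
  norm_le : ∀ x y, ‖f x y‖ ≤ 1

/-- Dephasing channels, which act by entrywise multiplication. -/
structure IsDephasing (Λ : SuperOp1) : Prop where
  apply_eq : ∀ ρ x y, Λ ρ x y = dephFactor Λ x y * ρ x y
  factor : IsDephFactor (dephFactor Λ)

theorem IsDephFactor.one : IsDephFactor fun _ _ => 1 :=
  ⟨fun _ => rfl, fun _ _ => star_one _, fun _ _ => by simp⟩

theorem IsDephFactor.mul {f g : Bit → Bit → ℂ} (hf : IsDephFactor f) (hg : IsDephFactor g) :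
    IsDephFactor fun x y => f x y * g x y :=
  ⟨fun x => by rw [hf.diag, hg.diag, one_mul],
    fun x y => by rw [star_mul', hf.conj, hg.conj],
    fun x y => by
      rw [norm_mul]; exact mul_le_one₀ (hf.norm_le x y) (norm_nonneg _) (hg.norm_le x y)⟩

theorem IsDephFactor.list_prod {ι : Type*} (F : ι → Bit → Bit → ℂ) (l : List ι)
    (h : ∀ i ∈ l, IsDephFactor (F i)) : IsDephFactor fun x y => (l.map fun i => F i x y).prod := by
  induction l with
  | nil => simpa using IsDephFactor.one
  | cons a l ih =>
    simp only [List.map_cons, List.prod_cons]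
    exact (h a (by simp)).mul (ih fun i hi => h i (by simp [hi]))

theorem isDephasing_of_apply {Λ : SuperOp1} {f : Bit → Bit → ℂ} (hf : IsDephFactor f)
    (h : ∀ ρ x y, Λ ρ x y = f x y * ρ x y) : IsDephasing Λ ∧ dephFactor Λ = f := by
  have e : dephFactor Λ = f := by
    ext x y; simp [dephFactor, h]
  exact ⟨⟨by rw [e]; exact h, by rw [e]; exact hf⟩, e⟩

theorem isDephasing_id : IsDephasing LinearMap.id ∧ dephFactor LinearMap.id = fun _ _ => 1 :=
  isDephasing_of_apply IsDephFactor.one fun ρ x y => by simp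

theorem conjBy_apply (A ρ : Op1) : conjBy A ρ = A * ρ * A.conjTranspose := by
  simp [conjBy, Matrix.mul_assoc]

theorem matMul_apply_bit (A B : Op1) (x y : Bit) : (A * B) x y = A x 0 * B 0 y + A x 1 * B 1 y := by
  rw [Matrix.mul_apply, sum_bit]

theorem conjBy_diagonal_apply (d : Bit → ℂ) (ρ : Op1) (x y : Bit) :
    conjBy (Matrix.diagonal d) ρ x y = d x * star (d y) * ρ x y := by
  rw [conjBy_apply, Matrix.diagonal_conjTranspose, Matrix.mul_diagonal, Matrix.diagonal_mul]
  simp only [Pi.star_apply]; ring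

theorem phaseFlip_isDephasing {p : ℝ} (hp : p ∈ Set.Icc (0 : ℝ) 1) :
    IsDephasing (phaseFlip p) ∧
      dephFactor (phaseFlip p) = fun x y => if x = y then 1 else ((1 - 2 * p : ℝ) : ℂ) := by
  apply isDephasing_of_apply
  · refine ⟨fun x => if_pos rfl, fun x y => ?_, fun x y => ?_⟩
    · by_cases h : x = y
      · subst h; simp
      · rw [if_neg h, if_neg (Ne.symm h)]; exact Complex.conj_ofReal _
    · by_cases h : x = y
      · simp [h]
      · rw [if_neg h, Complex.norm_real, Real.norm_eq_abs, abs_le]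
        constructor <;> linarith [hp.1, hp.2]
  · intro ρ x y
    simp only [phaseFlip, LinearMap.add_apply, LinearMap.smul_apply, LinearMap.id_apply,
      Matrix.add_apply, Matrix.smul_apply, smul_eq_mul, Pauli.mat, conjBy_diagonal_apply, star_sgn]
    by_cases h : x = y
    · subst h; simp; ring
    · rw [if_neg h]
      have : sgn x * sgn y = -1 := by
        rcases x.eq_zero_or_one with rfl | rfl <;> rcases y.eq_zero_or_one with rfl | rfl <;>
          simp at h ⊢
      rw [this]; push_cast; ring

theorem sum_pauli {M : Type*} [AddCommMonoid M] (f : Pauli → M) :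
    ∑ P, f P = f .I + f .X + f .Y + f .Z := by
  simp [Finset.univ, Fintype.elems, Finset.sum_insert, add_assoc]

theorem phaseFlip_isPauliChannel {p : ℝ} (hp : p ∈ Set.Icc (0 : ℝ) 1) :
    IsPauliChannel (phaseFlip p) := by
  refine ⟨fun P => match P with | .I => 1 - p | .Z => p | _ => 0, ?_, ?_, ?_⟩
  · rintro (_ | _ | _ | _) <;> simp [hp.1, hp.2]
  · rw [sum_pauli]; simp
  · have hI : conjBy Pauli.I.mat = LinearMap.id := by
      ext ρ : 1; simp [conjBy_apply, Pauli.mat]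
    rw [sum_pauli, hI]; simp [phaseFlip]

/-- A channel with `[N]_{Z,Z} = 1` has diagonal Kraus operators. -/
theorem isDephasing_of_channel {N : SuperOp1} (h : IsChannel N)
    (hZ : ptmEntry N Pauli.Z.mat Pauli.Z.mat = 1) : IsDephasing N := by
  obtain ⟨r, E, hE, rfl⟩ := h
  have hdiag : ∀ x, ∑ k, (star (E k 0 x) * E k 0 x + star (E k 1 x) * E k 1 x) = 1 := fun x => by
    have := congrFun (congrFun hE x) x
    rw [Matrix.sum_apply, Matrix.one_apply_eq] at this
    simpa only [matMul_apply_bit, Matrix.conjTranspose_apply] using this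
  have hz : ∑ k, (star (E k 0 0) * E k 0 0 + star (E k 1 1) * E k 1 1 -
      star (E k 0 1) * E k 0 1 - star (E k 1 0) * E k 1 0) = 2 := by
    have : (Pauli.Z.mat.conjTranspose * (∑ k, conjBy (E k)) Pauli.Z.mat).trace = 2 := by
      rw [ptmEntry] at hZ; linear_combination 2 * hZ
    rw [← this, LinearMap.sum_apply, Finset.mul_sum, Matrix.trace_sum]
    refine Finset.sum_congr rfl fun k _ => ?_
    rw [conjBy_apply, Matrix.trace, sum_bit]
    simp only [Matrix.diag_apply, matMul_apply_bit, Matrix.conjTranspose_apply, Pauli.mat,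
      Matrix.diagonal_apply]
    simp
    ring
  -- Trace preservation on both basis states gives total weight `2` of the Kraus entries; `hz` says
  -- diagonal minus off-diagonal weight is also `2`.
  have hoff : ∑ k, (‖E k 0 1‖ ^ 2 + ‖E k 1 0‖ ^ 2) = 0 := by
    have h2 : ∑ k, (star (E k 0 1) * E k 0 1 + star (E k 1 0) * E k 1 0) = 0 := by
      have h0 := hdiag 0
      have h1 := hdiag 1
      simp only [Finset.sum_add_distrib, Finset.sum_sub_distrib] at h0 h1 hz ⊢
      linear_combination (h0 + h1 - hz) / 2
    have h3 : ((∑ k, (‖E k 0 1‖ ^ 2 + ‖E k 1 0‖ ^ 2) : ℝ) : ℂ) = 0 := by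
      rw [← h2]; push_cast
      refine Finset.sum_congr rfl fun k _ => ?_
      rw [Complex.star_def, Complex.conj_mul', Complex.conj_mul']
    exact_mod_cast h3
  have hk : ∀ k, E k = Matrix.diagonal fun x => E k x x := fun k => by
    have h1 := (Finset.sum_eq_zero_iff_of_nonneg fun k _ => by positivity).1 hoff k
      (Finset.mem_univ k)
    have h01 : E k 0 1 = 0 := by
      have : ‖E k 0 1‖ ^ 2 = 0 := by nlinarith [sq_nonneg ‖E k 0 1‖, sq_nonneg ‖E k 1 0‖]
      simpa using this
    have h10 : E k 1 0 = 0 := by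
      have : ‖E k 1 0‖ ^ 2 = 0 := by nlinarith [sq_nonneg ‖E k 0 1‖, sq_nonneg ‖E k 1 0‖]
      simpa using this
    ext x y
    rcases x.eq_zero_or_one with rfl | rfl <;> rcases y.eq_zero_or_one with rfl | rfl <;>
      simp [h01, h10]
  have hone : ∀ x, ∑ k, E k x x * star (E k x x) = 1 := fun x => by
    rw [← hdiag x]
    refine Finset.sum_congr rfl fun k _ => ?_
    rw [hk k]
    rcases x.eq_zero_or_one with rfl | rfl <;> simp [mul_comm]
  have hnorm : ∀ x, ∑ k, ‖E k x x‖ ^ 2 = 1 := fun x => by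
    have : ((∑ k, ‖E k x x‖ ^ 2 : ℝ) : ℂ) = 1 := by
      rw [← hone x]; push_cast
      refine Finset.sum_congr rfl fun k _ => ?_
      rw [Complex.star_def, Complex.mul_conj']
    exact_mod_cast this
  refine (isDephasing_of_apply (f := fun x y => ∑ k, E k x x * star (E k y y))
    ⟨hone, fun x y => ?_, fun x y => ?_⟩ fun ρ x y => ?_).1
  · rw [star_sum]
    refine Finset.sum_congr rfl fun k _ => ?_
    rw [star_mul', star_star, mul_comm]
  · calc ‖∑ k, E k x x * star (E k y y)‖ ≤ ∑ k, ‖E k x x * star (E k y y)‖ := norm_sum_le _ _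
      _ ≤ ∑ k, (‖E k x x‖ ^ 2 + ‖E k y y‖ ^ 2) / 2 := Finset.sum_le_sum fun k _ => by
          rw [norm_mul, norm_star]; nlinarith [sq_nonneg (‖E k x x‖ - ‖E k y y‖)]
      _ = 1 := by rw [← Finset.sum_div, Finset.sum_add_distrib, hnorm, hnorm]; norm_num
  · rw [LinearMap.sum_apply, Matrix.sum_apply, Finset.sum_mul]
    refine Finset.sum_congr rfl fun k _ => ?_
    conv_lhs => rw [hk k]
    rw [conjBy_diagonal_apply]

/-! ### Products of Pauli transfer matrices -/

/-- The Pauli transfer matrix of the dephasing channel that multiplies `|0⟩⟨1|` by `μ`. -/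
noncomputable def dephPtm (μ : ℂ) : Matrix Pauli Pauli ℂ := Matrix.of fun P P' =>
  match P, P' with
  | .I, .I => 1
  | .Z, .Z => 1
  | .X, .X => (μ.re : ℂ)
  | .X, .Y => (μ.im : ℂ)
  | .Y, .X => -(μ.im : ℂ)
  | .Y, .Y => (μ.re : ℂ)
  | _, _ => 0

/-- The `X,Y` block is the real `2 × 2` matrix representation of a complex number. -/
theorem dephPtm_mul (μ ν : ℂ) : dephPtm μ * dephPtm ν = dephPtm (μ * ν) := by
  ext P P'
  rw [Matrix.mul_apply, sum_pauli]
  cases P <;> cases P' <;> simp [dephPtm] <;> ring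

theorem ptm_of_isDephasing {N : SuperOp1} (h : IsDephasing N) :
    ptm N = dephPtm (dephFactor N 0 1) := by
  have h10 : dephFactor N 1 0 = star (dephFactor N 0 1) := (h.factor.conj 0 1).symm
  have h00 := h.factor.diag 0
  have h11 := h.factor.diag 1
  ext P P'
  rw [ptm, Matrix.of_apply, ptmEntry, Matrix.trace, sum_bit]
  simp only [Matrix.diag_apply, matMul_apply_bit, Matrix.conjTranspose_apply, h.apply_eq, h00, h11,
    h10]
  generalize dephFactor N 0 1 = μ
  cases P <;> cases P' <;>
    simp [Pauli.mat, dephPtm, Complex.ext_iff]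

/-! ### Diagonal circuits -/

/-- The factor by which a diagonal step multiplies a matrix entry. -/
def Instr.factor {Q : Type} : Instr Q → (Q → Bit) → (Q → Bit) → ℂ
  | .cz u v, a, b => sgn (a u * a v) * sgn (b u * b v)
  | .noise v Λ, a, b => dephFactor Λ (a v) (b v)

/-- All noise in the step is dephasing. -/
def Instr.IsDiagonal {Q : Type} : Instr Q → Prop
  | .cz _ _ => True
  | .noise _ Λ => IsDephasing Λ

theorem onQubit_apply {Q : Type} [DecidableEq Q] (v : Q) {Λ : SuperOp1} (h : IsDephasing Λ)
    (ρ : Op Q) (a b : Q → Bit) : onQubit v Λ ρ a b = dephFactor Λ (a v) (b v) * ρ a b := by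
  rw [onQubit, Matrix.of_apply]
  simp only [h.apply_eq]
  rw [Finset.sum_eq_single (a v), Finset.sum_eq_single (b v)]
  · simp
  · intro y _ hy; simp [hy]
  · simp
  · intro x _ hx; simp [hx]
  · simp

theorem Instr.apply_apply {Q : Type} [DecidableEq Q] (g : Instr Q) (hg : g.IsDiagonal) (ρ : Op Q)
    (a b : Q → Bit) : g.apply ρ a b = g.factor a b * ρ a b := by
  cases g with
  | cz u v => simp only [Instr.apply, applyCZ, Matrix.of_apply, Instr.factor]; ring
  | noise v Λ => exact onQubit_apply v hg ρ a b

theorem runCircuit_apply {Q : Type} [DecidableEq Q] (c : List (Instr Q))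
    (hc : ∀ g ∈ c, g.IsDiagonal) (ρ : Op Q) (a b : Q → Bit) :
    runCircuit c ρ a b = (c.map fun g => g.factor a b).prod * ρ a b := by
  induction c generalizing ρ with
  | nil => simp [runCircuit]
  | cons g c ih =>
    have : runCircuit (g :: c) ρ = runCircuit c (g.apply ρ) := rfl
    rw [this, ih (fun g hg => hc g (by simp [hg])), g.apply_apply (hc g (by simp))]
    simp only [List.map_cons, List.prod_cons]; ring

theorem prod_map_flatMap {α β : Type*} (l : List α) (f : α → List β) (g : β → ℂ) :
    ((l.flatMap f).map g).prod = (l.map fun x => ((f x).map g).prod).prod := by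
  induction l with
  | nil => simp
  | cons a l ih => simp [ih]

theorem prod_map_finRange {r : ℕ} (f : Fin r → ℂ) : ((List.finRange r).map f).prod = ∏ i, f i := by
  rw [← List.ofFn_eq_map, List.prod_ofFn]

theorem prod_map_filter_finRange {r : ℕ} (s : Finset (Fin r)) (f : Fin r → ℂ) :
    (((List.finRange r).filter fun i => i ∈ s).map f).prod = ∏ i ∈ s, f i := by
  rw [← List.prod_toFinset f ((List.nodup_finRange r).filter _)]
  congr 1
  ext i; simp

variable {C : CSSCode n} {L : ℕ}

/-- The parity of `x` on the support of the generator `a`. -/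
def CSSCode.par (C : CSSCode n) (b : Kind) (a : Fin (C.num b)) (x : Fin n → Bit) : Bit :=
  ∑ i ∈ C.supp b a, x i

theorem CSSCode.par_add (C : CSSCode n) (b : Kind) (a : Fin (C.num b)) (x y : Fin n → Bit) :
    C.par b a (x + y) = C.par b a x + C.par b a y := by
  simp [CSSCode.par, Finset.sum_add_distrib]

/-- This is where the order of the gates drops out: only the set of scheduled pairs matters for a
commutative product. -/
theorem Schedule.prod_seq (S : Schedule C L) (k : Fin L) (b : Kind)
    (F : Fin (C.num b) → Fin n → ℂ) :
    ((S.seq k b).map fun x => F x.1 x.2).prod = ∏ a, ∏ i ∈ C.supp b a, F a i := by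
  rw [← List.prod_toFinset _ (S.nodup k b), Finset.prod_sigma']
  refine Finset.prod_bij' (fun x _ => ⟨x.1, x.2⟩) (fun x _ => (x.1, x.2)) ?_ ?_ ?_ ?_ ?_ <;>
    simp [S.mem_iff]

/-- The combined factor of the noise on an ancilla. -/
noncomputable def ancFactor (N : Loc C → SuperOp1) (k : ℕ) (b : Kind) (a : Fin (C.num b))
    (x y : Bit) : ℂ :=
  dephFactor (N (.ancPrep k b a)) x y *
    ∏ i ∈ C.supp b a, dephFactor (N (.ancStab k b a i)) x y

/-- The combined factor of the noise on a code qubit within its layer. -/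
noncomputable def codeFactor (N : Loc C → SuperOp1) (k : ℕ) (b : Kind) (i : Fin n)
    (x y : Bit) : ℂ :=
  dephFactor (N (.codePrep k b i)) x y * dephFactor (N (.codeIn k b i)) x y *
    ∏ a with i ∈ C.supp b a, dephFactor (N (.codeStab k b a i)) x y

theorem layerCircuit_factor (S : Schedule C L) (N : Loc C → SuperOp1) (k : Fin L) (b : Kind)
    (u v x y : Fin n → Bit) (c d : Fin (C.num b) → Bit) :
    ((layerCircuit S N k b).map fun g => g.factor (Sum.elim u (Sum.elim x c))
      (Sum.elim v (Sum.elim y d))).prod =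
    (∏ i, sgn (u i * x i) * sgn (v i * y i) * dephFactor (outNoise N k b i) (u i) (v i) *
      codeFactor N k b i (x i) (y i)) *
    ∏ a, sgn (c a * C.par b a x) * sgn (d a * C.par b a y) * ancFactor N k b a (c a) (d a) := by
  -- Regroups the code-qubit noise of the stabilizer gates from ancillas to code qubits.
  have hswap : ∏ a, ∏ i ∈ C.supp b a, dephFactor (N (.codeStab k b a i)) (x i) (y i) =
      ∏ i, ∏ a with i ∈ C.supp b a, dephFactor (N (.codeStab k b a i)) (x i) (y i) :=
    Finset.prod_comm' (by simp)
  simp only [layerCircuit, List.map_append, List.prod_append, List.map_map, Function.comp_def,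
    prod_map_flatMap, List.map_cons, List.map_nil, List.prod_cons, List.prod_nil, mul_one,
    Instr.factor, Sum.elim_inl, Sum.elim_inr, prod_map_finRange]
  rw [S.prod_seq k b fun a i => (sgn (c a * x i) * sgn (d a * y i) *
    (dephFactor (N (.ancStab k b a i)) (c a) (d a) *
      dephFactor (N (.codeStab k b a i)) (x i) (y i)))]
  simp only [CSSCode.par, Finset.mul_sum, sgn_sum, codeFactor, ancFactor, Finset.prod_mul_distrib,
    hswap]
  ring

/-- The factor of the noisy measurement by an ancilla, where `α` and `β` are the sums of the
reported outcome and the actual ones. -/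
noncomputable def readout (f : Bit → Bit → ℂ) (α β : Bit) : ℂ :=
  ∑ c, ∑ d, 1 / 4 * (sgn (α * c) * sgn (β * d) * f c d)

/-- A layer of the foliation, as Hadamard gates, bit flips, and entrywise multiplication. -/
theorem layer_apply (S : Schedule C L) (N : Loc C → SuperOp1) (k : Fin L) (b : Kind)
    (hN : ∀ g ∈ layerCircuit S N k b, g.IsDiagonal) (m : Fin n → Bit) (s : Fin (C.num b) → Bit)
    (ρ : Op (Fin n)) (x y : Fin n → Bit) :
    layer S N k b m s ρ x y =
      (∏ i, codeFactor N k b i (x i) (y i)) *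
      (∏ a, readout (ancFactor N k b a) (s a + C.par b a x) (s a + C.par b a y)) *
      ((1 / 2) ^ n * hadConj
        (Matrix.of fun u v => (∏ i, dephFactor (outNoise N k b i) (u i) (v i)) * ρ u v)
        (x + m) (y + m)) := by
  simp only [layer, measureX, Matrix.of_apply, runCircuit_apply _ hN, layerCircuit_factor, prepare,
    Sum.elim_inl, hadConj_apply, readout, prod_sum_pi]
  -- Preparation and measurement each give `1/2` per qubit. The ancillas absorb theirs as the `1/4`
  -- in `readout`; of the two factors `(1/2)^n` for the chains, one normalizes `hadConj` and the
  -- other stays as the weight of a teleportation outcome.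
  have hreg : ∀ (A P Q : ℂ) (g : (Fin n → Bit) → (Fin n → Bit) → ℂ)
      (h : (Fin (C.num b) → Bit) → (Fin (C.num b) → Bit) → ℂ),
      A * (∑ c, ∑ d, h c d) * (P * (Q * ∑ u, ∑ v, g u v)) =
        ∑ u, ∑ v, ∑ c, ∑ d, A * h c d * (P * (Q * g u v)) := fun A P Q g h => by
    simp only [Finset.mul_sum, Finset.sum_mul]
  rw [hreg]
  refine Finset.sum_congr rfl fun u _ => Finset.sum_congr rfl fun v _ =>
    Finset.sum_congr rfl fun c _ => Finset.sum_congr rfl fun d _ => ?_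
  simp only [sgn_dotProduct, Pi.add_apply, add_mul, sgn_add, Finset.prod_mul_distrib,
    Finset.prod_div_distrib, Finset.prod_const, Finset.card_univ, Fintype.card_fin, pow_add,
    mul_comm (c _) (C.par _ _ _), mul_comm (d _) (C.par _ _ _), mul_comm (x _), mul_comm (y _)]
  simp only [div_eq_mul_inv, one_mul, inv_pow]
  rw [show (4 : ℂ) = 2 * 2 by norm_num, mul_pow]
  ring

/-! ### Iteration over rounds -/

theorem foldl_finRange_rel {α β : Type*} {L : ℕ} (f : α → Fin L → α) (g : β → Fin L → β)
    (R : ℕ → α → β → Prop) {a : α} {b : β} (h0 : R 0 a b)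
    (hstep : ∀ (k : Fin L) a b, R k a b → R (k + 1) (f a k) (g b k)) :
    R L ((List.finRange L).foldl f a) ((List.finRange L).foldl g b) := by
  induction L generalizing a b R with
  | zero => simpa using h0
  | succ L ih =>
    rw [List.finRange_succ, List.foldl_cons, List.foldl_cons, List.foldl_map, List.foldl_map]
    refine ih _ _ (fun k => R (k + 1)) ?_ fun k a b h => ?_
    · simpa using hstep 0 a b h0
    · simpa using hstep k.succ a b (by simpa using h)

/-- By linearity of the last step, the sum over the earlier choices moves inside it. -/
theorem sum_foldl_finRange {A V : Type*} [Fintype A] [AddCommMonoid V] [Module ℂ V] {L : ℕ}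
    (B : Fin L → A → V →ₗ[ℂ] V) (v : V) :
    ∑ g : Fin L → A, (List.finRange L).foldl (fun v k => B k (g k) v) v =
      (List.finRange L).foldl (fun v k => ∑ a, B k a v) v := by
  induction L with
  | zero => simp
  | succ L ih =>
    rw [List.finRange_succ_last, List.foldl_append, List.foldl_map, ← ih]
    rw [← Equiv.sum_comp (Fin.snocEquiv fun _ => A), Fintype.sum_prod_type]
    simp only [List.foldl_append, List.foldl_map, List.foldl_cons, List.foldl_nil, Fin.snocEquiv,
      Equiv.coe_fn_mk, Fin.snoc_last, Fin.snoc_castSucc, map_sum]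

/-- Pairs indexed by the two kinds. -/
def kindPiEquiv (α : Type*) : (Kind → α) ≃ α × α where
  toFun f := (f .X, f .Z)
  invFun p b := match b with | .X => p.1 | .Z => p.2
  left_inv f := by ext b; cases b <;> rfl
  right_inv _ := rfl

theorem sum_kind_comp {A V : Type*} [Fintype A] [AddCommMonoid V] [Module ℂ V]
    (B : Kind → A → V →ₗ[ℂ] V) (v : V) :
    ∑ h : Kind → A, B .Z (h .Z) (B .X (h .X) v) = ∑ c, B .Z c (∑ a, B .X a v) := by
  rw [← Equiv.sum_comp (kindPiEquiv A).symm, Fintype.sum_prod_type, Finset.sum_comm]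
  simp [kindPiEquiv, map_sum]

/-! ### Consecutive differences and partial sums modulo two -/

section Differences

variable {A : Type*} [AddCommGroup A] {L : ℕ}

/-- The entry before index `k`, or zero. -/
def prevEntry (g : Fin L → A) (k : ℕ) : A :=
  if h : 0 < k ∧ k ≤ L then g ⟨k - 1, by omega⟩ else 0

@[simp] theorem prevEntry_zero (g : Fin L → A) : prevEntry g 0 = 0 := by simp [prevEntry]

@[simp] theorem prevEntry_succ (g : Fin L → A) (k : Fin L) : prevEntry g (k + 1) = g k := by
  simp [prevEntry]

/-- Sums of consecutive entries. -/
def consecSum (g : Fin L → A) : Fin L → A := fun k => g k + prevEntry g k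

/-- Partial sums. -/
def partialSum (g : Fin L → A) : Fin L → A := fun k => ∑ j ∈ Finset.Iic k, g j

theorem partialSum_eq (g : Fin L → A) (k : Fin L) :
    partialSum g k = g k + prevEntry (partialSum g) k := by
  obtain ⟨k, hk⟩ := k
  cases k with
  | zero =>
    have : Finset.Iic (⟨0, hk⟩ : Fin L) = {⟨0, hk⟩} := by
      ext j; simp [Fin.le_def, Fin.ext_iff]
    simp [partialSum, this]
  | succ k =>
    have hk' : k < L := by omega
    have h := prevEntry_succ (partialSum g) ⟨k, hk'⟩
    have : Finset.Iic (⟨k + 1, hk⟩ : Fin L) = insert ⟨k + 1, hk⟩ (Finset.Iic ⟨k, hk'⟩) := by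
      ext j; simp only [Finset.mem_Iic, Finset.mem_insert, Fin.le_def, Fin.ext_iff]; omega
    simp only at h
    rw [h, partialSum, this, Finset.sum_insert (by simp [Fin.le_def])]
    rfl

theorem eq_of_consecutive {f g h : Fin L → A} (hf : ∀ k : Fin L, f k = h k + prevEntry f k)
    (hg : ∀ k : Fin L, g k = h k + prevEntry g k) : f = g := by
  have : ∀ (k : ℕ) (hk : k < L), f ⟨k, hk⟩ = g ⟨k, hk⟩ := by
    intro k
    induction k with
    | zero => intro hk; rw [hf, hg]; simp
    | succ k ih =>
      intro hk
      have h1 := prevEntry_succ f ⟨k, by omega⟩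
      have h2 := prevEntry_succ g ⟨k, by omega⟩
      simp only at h1 h2
      rw [hf, hg, h1, h2, ih]
  ext ⟨k, hk⟩
  exact this k hk

theorem partialSum_consecSum (hA : ∀ a : A, a + a = 0) (g : Fin L → A) :
    partialSum (consecSum g) = g :=
  eq_of_consecutive (partialSum_eq _) fun k => by rw [consecSum, add_assoc, hA, add_zero]

theorem consecSum_partialSum (hA : ∀ a : A, a + a = 0) (g : Fin L → A) :
    consecSum (partialSum g) = g := by
  ext k
  rw [consecSum, partialSum_eq, add_assoc, hA, add_zero]

end Differences

/-! ### The combined noise on a physical qubit -/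

/-- The product of the factors at all locations of a physical qubit. -/
def siteFactor (L : ℕ) (N : Loc C → SuperOp1) (γ : Site C) (x y : Bit) : ℂ :=
  ((γ.locs L).map fun l => dephFactor (N l) x y).prod

/-- The factor at the last location of the code qubit that enters round `k`. The input and the
output of the whole foliation have no such location. -/
def carryFactor (L : ℕ) (N : Loc C → SuperOp1) (k : ℕ) (i : Fin n) (x y : Bit) : ℂ :=
  if k = 0 ∨ k = L then 1 else dephFactor (N (.codeOut (k - 1) .Z i)) x y

theorem siteFactor_anc (N : Loc C → SuperOp1) (k : ℕ) (b : Kind) (a : Fin (C.num b)) :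
    siteFactor L N (.anc k b a) = ancFactor N k b a := by
  ext x y
  simp only [siteFactor, Site.locs, List.map_cons, List.prod_cons, List.map_map,
    Function.comp_def, prod_map_filter_finRange, ancFactor]

theorem siteFactor_code (N : Loc C → SuperOp1) (k : ℕ) (b : Kind) (i : Fin n) (x y : Bit) :
    siteFactor L N (.code k b i) x y = codeFactor N k b i x y *
      if b = .Z ∧ k + 1 = L then 1 else dephFactor (N (.codeOut k b i)) x y := by
  have h := prod_map_filter_finRange (Finset.univ.filter fun a => i ∈ C.supp b a)
    fun a => dephFactor (N (.codeStab k b a i)) x y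
  simp only [Finset.mem_filter, Finset.mem_univ, true_and] at h
  simp only [siteFactor, Site.locs, List.map_append, List.prod_append, List.map_cons,
    List.prod_cons, List.map_map, Function.comp_def, h, codeFactor, List.map_nil, List.prod_nil,
    mul_one]
  split_ifs <;> simp

theorem Site.mem_locs_site (γ : Site C) (l : Loc C) (h : l ∈ γ.locs L) : l.site = γ := by
  cases γ with
  | code k b i =>
    simp only [Site.locs, List.mem_append, List.mem_cons, List.mem_map] at h
    split_ifs at h <;> aesop
  | anc k b a =>
    simp only [Site.locs, List.mem_cons, List.mem_map] at h
    aesop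

theorem Site.occurs_of_mem {γ : Site C} (hγ : γ.round < L) {l : Loc C} (h : l ∈ γ.locs L) :
    l.Occurs L := by
  have := γ.mem_locs_site l h
  exact ⟨this ▸ hγ, this ▸ h⟩

/-- The noise consists of dephasing channels at all locations of the foliation. -/
def DephasingNoise (L : ℕ) (N : Loc C → SuperOp1) : Prop :=
  ∀ l : Loc C, l.Occurs L → IsDephasing (N l)

theorem DephasingNoise.siteFactor {N : Loc C → SuperOp1} (hN : DephasingNoise L N) {γ : Site C}
    (hγ : γ.round < L) : IsDephFactor (siteFactor L N γ) :=
  IsDephFactor.list_prod (fun l => dephFactor (N l)) _ fun _ hl =>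
    (hN _ (Site.occurs_of_mem hγ hl)).factor

theorem DephasingNoise.outNoise {N : Loc C → SuperOp1} (hN : DephasingNoise L N) (k : Fin L)
    (b : Kind) (i : Fin n) : IsDephasing (outNoise N k b i) := by
  cases b with
  | X =>
    rw [Foliation.outNoise]
    split_ifs with h
    · exact isDephasing_id.1
    · refine hN _ (Site.occurs_of_mem (γ := .code (k - 1) .Z i) ?_ ?_)
      · have := k.2; simp only [Site.round]; omega
      -- Round `k - 1` is not the last one, so its code qubits do have a successor.
      · have : ¬ (k.val - 1 + 1 = L) := by have := k.2; omega
        simp [Site.locs, this]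
  | Z =>
    exact hN _ (Site.occurs_of_mem (γ := .code k .X i) k.2 (by simp [Site.locs]))

theorem DephasingNoise.layerCircuit {N : Loc C → SuperOp1} (hN : DephasingNoise L N)
    (S : Schedule C L) (k : Fin L) (b : Kind) :
    ∀ g ∈ layerCircuit S N k b, g.IsDiagonal := by
  intro g hg
  have hcode : ∀ i, ∀ l ∈ (Site.code (C := C) k b i).locs L, IsDephasing (N l) :=
    fun i l hl => hN l (Site.occurs_of_mem k.2 hl)
  have hanc : ∀ a, ∀ l ∈ (Site.anc (C := C) k b a).locs L, IsDephasing (N l) :=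
    fun a l hl => hN l (Site.occurs_of_mem k.2 hl)
  simp only [Foliation.layerCircuit, List.mem_append, List.mem_map, List.mem_flatMap, List.mem_cons,
    List.not_mem_nil, or_false] at hg
  rcases hg with ((⟨i, -, rfl⟩ | ⟨a, -, rfl⟩) | ⟨i, -, rfl | rfl | rfl⟩) |
    ⟨⟨a, i⟩, hx, rfl | rfl | rfl⟩
  · exact hcode i _ (by simp [Site.locs])
  · exact hanc a _ (by simp [Site.locs])
  · trivial
  · exact hN.outNoise k b i
  · exact hcode i _ (by simp [Site.locs])
  · trivial
  · have := (S.mem_iff k b _).1 hx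
    exact hanc a _ (by simpa [Site.locs] using this)
  · have := (S.mem_iff k b _).1 hx
    exact hcode i _ (by simpa [Site.locs] using this)

/-! ### The foliation in the Pauli frame -/

/-- Entrywise multiplication. -/
def mulEntries (M : (Fin n → Bit) → (Fin n → Bit) → ℂ) : Op (Fin n) →ₗ[ℂ] Op (Fin n) where
  toFun ρ := Matrix.of fun x y => M x y * ρ x y
  map_add' ρ τ := by ext x y; simp [mul_add]
  map_smul' c ρ := by ext x y; simp; ring

theorem mulEntries_apply (M : (Fin n → Bit) → (Fin n → Bit) → ℂ) (ρ : Op (Fin n))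
    (x y : Fin n → Bit) : mulEntries M ρ x y = M x y * ρ x y := rfl

/-- The factors of the noisy measurement of all generators of kind `b`. -/
noncomputable def readoutFactor (L : ℕ) (N : Loc C → SuperOp1) (k : ℕ) (b : Kind)
    (s : Fin (C.num b) → Bit) (x y : Fin n → Bit) : ℂ :=
  ∏ a, readout (siteFactor L N (.anc k b a)) (s a + C.par b a x) (s a + C.par b a y)

/-- A layer in the Pauli frame, where `g` is the part of the frame that affects the noise. -/
noncomputable def frameLayer (L : ℕ) (N : Loc C → SuperOp1) (k : ℕ) (b : Kind)
    (s : Fin (C.num b) → Bit) (g : Fin n → Bit) : Op (Fin n) →ₗ[ℂ] Op (Fin n) :=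
  mulEntries (fun x y => (1 / 2) ^ n *
    (∏ i, siteFactor L N (.code k b i) (x i + g i) (y i + g i)) *
    readoutFactor L N k b s x y) ∘ₗ hadConj

/-- The Hadamard gates swap the two parts of the frame and the outcomes `m` are added to the new `X`
part. This shift displaces the arguments of the code factors; in the readouts it is absorbed by the
parity of `g + m` added to `s`. The factor `next` is noise that physically acts in the next layer.
Being diagonal, it can be applied before the next Hadamard gates together with the noise of this
layer, which completes `siteFactor`. -/
theorem layer_frame (S : Schedule C L) {N : Loc C → SuperOp1} (hN : DephasingNoise L N)
    (k : Fin L) (b : Kind) (m f g : Fin n → Bit) (s : Fin (C.num b) → Bit)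
    (next : Fin n → Bit → Bit → ℂ)
    (hnext : ∀ i x y, siteFactor L N (.code k b i) x y = codeFactor N k b i x y * next i x y)
    (ρ τ : Op (Fin n))
    (h : mulEntries (fun x y => ∏ i, dephFactor (outNoise N k b i) (x i) (y i)) ρ =
      frameConj f g τ) :
    mulEntries (fun x y => ∏ i, next i (x i) (y i))
      (layer S N k b m (fun a => s a + C.par b a (g + m)) ρ) =
      frameConj (g + m) f (frameLayer L N k b s (g + m) τ) := by
  ext x y
  have h' : (Matrix.of fun u v => (∏ i, dephFactor (outNoise N k b i) (u i) (v i)) * ρ u v) =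
      frameConj f g τ := h
  have hc : ∀ i (z : Fin n → Bit), (z + (g + m)) i + (g + m) i = z i := fun i z =>
    congrFun (vec_add_add_cancel z (g + m)) i
  rw [mulEntries_apply, layer_apply S N k b (hN.layerCircuit S k b), h', hadConj_frameConj]
  simp only [frameConj, Matrix.of_apply, frameLayer, LinearMap.comp_apply, mulEntries_apply, hc,
    readoutFactor, CSSCode.par_add C b _ _ (g + m), hnext, siteFactor_anc, Finset.prod_mul_distrib]
  rw [show x + m + (y + m) = x + y by rw [add_add_add_comm, vec_add_self, add_zero],
    show x + m + g = x + (g + m) by rw [add_assoc, add_comm m],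
    show y + m + g = y + (g + m) by rw [add_assoc, add_comm m]]
  simp only [add_right_comm _ (C.par b _ (g + m)) (C.par b _ _), add_assoc]
  ring

/-- The sum telescopes mod 2, so the final Pauli correction depends only on the last frame. -/
theorem sum_consecSum {A : Type*} [AddCommGroup A] (hA : ∀ a : A, a + a = 0) (g : Fin L → A) :
    ∑ k, consecSum g k = prevEntry g L := by
  cases L with
  | zero => simp
  | succ L =>
    have h := congrFun (partialSum_consecSum hA g) (Fin.last L)
    have h2 := prevEntry_succ g (Fin.last L)
    simp only [Fin.val_last] at h2
    rw [h2, ← h, partialSum]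
    congr 1
    ext j; simp [Fin.le_last]

theorem pauliFrame_consecSum (g : TeleOutcomes n L) :
    pauliFrame (consecSum g) =
      pauliOp .X (prevEntry g L .Z) * pauliOp .Z (prevEntry g L .X) := by
  have h : ∀ b, (fun i => ∑ k, consecSum g k b i) = prevEntry g L b := fun b => by
    rw [← sum_consecSum (fun a : Kind → Fin n → Bit => by
      ext b i; exact Bit.add_self _) g]
    ext i; simp
  rw [pauliFrame, h, h]

/-- The state in the Pauli frame after all rounds. -/
noncomputable def frameRun (N : Loc C → SuperOp1) (s : StabOutcomes C L) (g : TeleOutcomes n L)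
    (ρ : Op (Fin n)) : Op (Fin n) :=
  (List.finRange L).foldl (fun ρ (k : Fin L) => frameLayer L N k .Z (s k .Z) (g k .Z)
    (frameLayer L N k .X (s k .X) (g k .X) ρ)) ρ

theorem foliate_frame (S : Schedule C L) {N : Loc C → SuperOp1} (hN : DephasingNoise L N)
    (s : StabOutcomes C L) (g : TeleOutcomes n L) (ρ : Op (Fin n)) :
    foliate S N (consecSum g) (fun k b a => s k b a + C.par b a (g k b)) ρ =
      frameConj (prevEntry g L .Z) (prevEntry g L .X) (frameRun N s g ρ) := by
  have hone : ∀ ρ : Op (Fin n), mulEntries (fun _ _ => 1) ρ = ρ := fun ρ => by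
    ext x y; simp [mulEntries_apply]
  have key := foldl_finRange_rel
    (fun ρ (k : Fin L) => layer S N k .Z (consecSum g k .Z)
      (fun a => s k .Z a + C.par .Z a (g k .Z))
      (layer S N k .X (consecSum g k .X) (fun a => s k .X a + C.par .X a (g k .X)) ρ))
    (fun ρ (k : Fin L) => frameLayer L N k .Z (s k .Z) (g k .Z)
      (frameLayer L N k .X (s k .X) (g k .X) ρ))
    -- Invariant before round `k`: the physical state `ρ`, with the still pending noise at the end
    -- of the previous round, is the frame state `τ` conjugated by the current Pauli frame.
    (fun k ρ τ => mulEntries (fun x y => ∏ i, carryFactor L N k i (x i) (y i)) ρ =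
      frameConj (prevEntry g k .Z) (prevEntry g k .X) τ)
    (a := ρ) (b := ρ) ?_ ?_
  · rw [frameRun, ← key]
    simp [carryFactor, hone, foliate]
  · simp [carryFactor, hone, frameConj_zero]
  · intro k ρ τ h
    have hg : ∀ b, prevEntry g k b + consecSum g k b = g k b := fun b => by
      simp only [consecSum, Pi.add_apply]
      rw [add_comm (g k b), ← add_assoc, vec_add_self, zero_add]
    have h1 := layer_frame S hN k .X (consecSum g k .X) _ _ (s k .X)
      (fun i => dephFactor (outNoise N k .Z i))
      (fun i x y => by rw [siteFactor_code]; simp [outNoise]) ρ τ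
      (by
        rw [← h]
        congr 2
        ext x y
        refine Finset.prod_congr rfl fun i _ => ?_
        have hk : ¬ k.val = L := k.2.ne
        by_cases h0 : k.val = 0
        · simp [carryFactor, outNoise, h0, isDephasing_id.2]
        · simp [carryFactor, outNoise, h0, hk])
    rw [hg] at h1
    have h2 := layer_frame S hN k .Z (consecSum g k .Z) _ _ (s k .Z)
      (carryFactor L N (k + 1))
      (fun i x y => by rw [siteFactor_code]; simp [carryFactor]) _ _ h1
    rw [hg] at h2
    rw [prevEntry_succ]
    exact h2

theorem clusterSyndrome_eq_iff (g : TeleOutcomes n L) (s σ : StabOutcomes C L) :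
    clusterSyndrome (consecSum g) s = σ ↔
      s = fun k b a => frameSyndrome σ k b a + C.par b a (g k b) := by
  have hA : ∀ a : (b : Kind) → Fin (C.num b) → Bit, a + a = 0 := fun a => by
    ext b i; exact Bit.add_self _
  set t : StabOutcomes C L := fun k b a => C.par b a (g k b) with ht
  have hσ : frameSyndrome σ = partialSum σ := by
    ext k b a; simp [frameSyndrome, partialSum]
  -- The parity is additive, so the syndrome is the consecutive sum of the corrected outcomes `s +
  -- t`; inverting it by partial sums determines `s`.
  have h1 : clusterSyndrome (consecSum g) s = consecSum (s + t) := by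
    ext k b a
    have hp : ∀ (f : StabOutcomes C L), prevEntry f k b a =
        if h : 0 < k.val then f ⟨k.val - 1, by omega⟩ b a else 0 := fun f => by
      have := k.2.le
      by_cases h : 0 < k.val <;> simp [prevEntry, h, this]
    have hp' : C.par b a (prevEntry g k b) =
        if h : 0 < k.val then t ⟨k.val - 1, by omega⟩ b a else 0 := by
      have := k.2.le
      by_cases h : 0 < k.val <;> simp [prevEntry, h, this, ht, CSSCode.par]
    have : clusterSyndrome (consecSum g) s k b a = s k b a +
        (if 0 < k.val then s ⟨k.val - 1, by omega⟩ b a else 0) +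
        C.par b a (g k b + prevEntry g k b) := rfl
    rw [this, CSSCode.par_add, hp']
    simp only [consecSum, Pi.add_apply, hp, ht]
    by_cases h : 0 < k.val
    · simp only [h, if_true, dif_pos]; ring
    · simp only [h, if_false, dif_neg, not_false_eq_true]; ring
  rw [h1, hσ]
  constructor
  · rintro rfl
    rw [partialSum_consecSum hA]
    ext k b a
    simp only [Pi.add_apply, ht]
    rw [add_assoc, Bit.add_self, add_zero]
  · intro hs
    have : s + t = partialSum σ := by
      rw [hs]; ext k b a
      simp only [Pi.add_apply, ht]
      rw [add_assoc, Bit.add_self, add_zero]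
    rw [this, consecSum_partialSum hA]

/-- Teleportation outcomes are in bijection with the Pauli frames after each layer. -/
def frameEquiv (n L : ℕ) : TeleOutcomes n L ≃ TeleOutcomes n L where
  toFun := consecSum
  invFun := partialSum
  left_inv := partialSum_consecSum fun a => by ext b i; exact Bit.add_self _
  right_inv := consecSum_partialSum fun a => by ext b i; exact Bit.add_self _

theorem foliationOutput_eq_sum (S : Schedule C L) {N : Loc C → SuperOp1}
    (hN : DephasingNoise L N) (σ : StabOutcomes C L) (ρ : Op (Fin n)) :
    foliationOutput S N σ ρ = ∑ g : TeleOutcomes n L, frameRun N (frameSyndrome σ) g ρ := by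
  rw [foliationOutput, ← Equiv.sum_comp (frameEquiv n L)]
  refine Finset.sum_congr rfl fun g _ => ?_
  simp only [frameEquiv, Equiv.coe_fn_mk, clusterSyndrome_eq_iff, Finset.sum_ite_eq',
    Finset.mem_univ, if_true]
  rw [foliate_frame S hN, pauliFrame_consecSum, frame_undo]

/-- The factor of a code qubit, averaged over the Pauli frame. -/
noncomputable def meanFactor (f : Bit → Bit → ℂ) (x y : Bit) : ℂ :=
  if x = y then 1 else ((f 0 1).re : ℂ)

/-- A simultaneous flip of both arguments exchanges `f 0 1` with its conjugate, so the average is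
the real part. This is the twirl by the Pauli frame. -/
theorem IsDephFactor.sum_shift {f : Bit → Bit → ℂ} (hf : IsDephFactor f) (x y : Bit) :
    ∑ c, 1 / 2 * f (x + c) (y + c) = meanFactor f x y := by
  have h10 : f 1 0 = star (f 0 1) := (hf.conj 0 1).symm
  have h := Complex.add_conj (f 0 1)
  push_cast at h
  have e : (1 : Bit) + 1 = 0 := Bit.add_self 1
  rw [sum_bit, meanFactor]
  rcases x.eq_zero_or_one with rfl | rfl <;> rcases y.eq_zero_or_one with rfl | rfl <;>
    simp [e, hf.diag, h10]
  · norm_num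
  · linear_combination h / 2
  · linear_combination h / 2
  · norm_num

/-- A layer in the Pauli frame, averaged over the outcomes of the teleportations. -/
noncomputable def meanLayer (L : ℕ) (N : Loc C → SuperOp1) (k : ℕ) (b : Kind)
    (s : Fin (C.num b) → Bit) : Op (Fin n) →ₗ[ℂ] Op (Fin n) :=
  mulEntries (fun x y => (∏ i, meanFactor (siteFactor L N (.code k b i)) (x i) (y i)) *
    readoutFactor L N k b s x y) ∘ₗ hadConj

theorem sum_frameLayer {N : Loc C → SuperOp1} (hN : DephasingNoise L N) (k : Fin L) (b : Kind)
    (s : Fin (C.num b) → Bit) (ρ : Op (Fin n)) :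
    ∑ g, frameLayer L N k b s g ρ = meanLayer L N k b s ρ := by
  ext x y
  have h : ∀ i, IsDephFactor (siteFactor L N (.code k b i)) := fun i => hN.siteFactor k.2
  simp only [Matrix.sum_apply, frameLayer, meanLayer, LinearMap.comp_apply, mulEntries_apply,
    ← (h _).sum_shift, prod_sum_pi, Finset.sum_mul, Finset.prod_mul_distrib, Finset.prod_const,
    Finset.card_univ, Fintype.card_fin]

theorem foliationOutput_eq_foldl (S : Schedule C L) {N : Loc C → SuperOp1}
    (hN : DephasingNoise L N) (σ : StabOutcomes C L) (ρ : Op (Fin n)) :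
    foliationOutput S N σ ρ = (List.finRange L).foldl
      (fun ρ (k : Fin L) => meanLayer L N k .Z (frameSyndrome σ k .Z)
        (meanLayer L N k .X (frameSyndrome σ k .X) ρ)) ρ := by
  rw [foliationOutput_eq_sum S hN]
  have h := sum_foldl_finRange (fun (k : Fin L) (h : Kind → Fin n → Bit) =>
    frameLayer L N k .Z (frameSyndrome σ k .Z) (h .Z) ∘ₗ
      frameLayer L N k .X (frameSyndrome σ k .X) (h .X)) ρ
  simp only [LinearMap.comp_apply] at h
  refine h.trans ?_
  congr 1
  ext1 ρ; ext1 k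
  rw [sum_kind_comp fun b g => frameLayer L N k b (frameSyndrome σ k b) g, sum_frameLayer hN,
    sum_frameLayer hN]

/-! ### The code under flips, as entrywise multiplication -/

/-- The indicator vector of the support of a generator. -/
def CSSCode.ind (C : CSSCode n) (b : Kind) (a : Fin (C.num b)) : Fin n → Bit :=
  fun i => if i ∈ C.supp b a then 1 else 0

theorem CSSCode.ind_dotProduct (C : CSSCode n) (b : Kind) (a : Fin (C.num b)) (x : Fin n → Bit) :
    C.ind b a ⬝ᵥ x = C.par b a x := by
  simp [CSSCode.ind, dotProduct, CSSCode.par]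

/-- The probability of the flip `f`. -/
def bitWeight (q : ℝ) (f : Bit) : ℝ := if f = 0 then 1 - q else q

theorem flipWeight_eq {r : ℕ} (q : Fin r → ℝ) (e : Fin r → Bit) :
    (flipWeight q e : ℂ) = ∏ i, (bitWeight (q i) (e i) : ℂ) := by
  rw [flipWeight, Complex.ofReal_prod]; rfl

theorem flipNoise_Z_apply (q : Fin n → ℝ) (ρ : Op (Fin n)) (x y : Fin n → Bit) :
    flipNoise .Z q ρ x y = (∏ i, if x i = y i then 1 else ((1 - 2 * q i : ℝ) : ℂ)) * ρ x y := by
  -- Each factor is the Fourier transform of the flip distribution on one bit.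
  have h : ∀ i, (if x i = y i then 1 else ((1 - 2 * q i : ℝ) : ℂ)) =
      ∑ c, (bitWeight (q i) c : ℂ) * sgn (c * (x i + y i)) := fun i => by
    rw [sum_bit]
    have e : (1 : Bit) + 1 = 0 := Bit.add_self 1
    rcases (x i).eq_zero_or_one with hx | hx <;> rcases (y i).eq_zero_or_one with hy | hy <;>
      simp [hx, hy, e, bitWeight] <;> ring
  simp only [flipNoise, Matrix.sum_apply, pauliOp_conjTranspose, pauliOp_Z_conj, Matrix.smul_apply,
    frameConj, Matrix.of_apply, h, prod_sum_pi, Finset.sum_mul, smul_eq_mul, flipWeight_eq,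
    sgn_dotProduct, Pi.add_apply, add_zero, Finset.prod_mul_distrib]
  simp only [mul_assoc]

/-- The product of the projectors of the operators `∏ᵢ Zᵢ` on the supports of generators. -/
noncomputable def zProjector (C : CSSCode n) (b : Kind) (s : Fin (C.num b) → Bit) : Op (Fin n) :=
  (List.ofFn fun a => (1 / 2 : ℂ) • (1 + sgn (s a) • pauliOp .Z (C.ind b a))).prod

theorem zProjector_eq (C : CSSCode n) (b : Kind) (s : Fin (C.num b) → Bit) :
    zProjector C b s = Matrix.diagonal fun x => ∏ a, (1 + sgn (s a + C.par b a x)) / 2 := by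
  have h : ∀ a, (1 / 2 : ℂ) • (1 + sgn (s a) • pauliOp .Z (C.ind b a)) =
      Matrix.diagonalRingHom (Fin n → Bit) ℂ fun x => (1 + sgn (s a + C.par b a x)) / 2 := by
    intro a
    ext x y
    simp only [Matrix.smul_apply, Matrix.add_apply, pauliOp_Z_apply, Matrix.one_apply,
      CSSCode.ind_dotProduct, smul_eq_mul, Matrix.diagonalRingHom_apply, Matrix.diagonal_apply,
      sgn_add]
    split_ifs
    · ring
    · simp
  rw [zProjector]
  simp only [h]
  have hmap := List.map_ofFn (f := fun a x => (1 + sgn (s a + C.par b a x)) / 2)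
    (g := Matrix.diagonalRingHom (Fin n → Bit) ℂ)
  rw [Function.comp_def] at hmap
  rw [← hmap, ← map_list_prod, List.prod_ofFn, Matrix.diagonalRingHom_apply]
  congr 1
  ext x; simp

/-- The factor of the measurement of a generator whose outcome is flipped with probability `q`. -/
noncomputable def flippedReadout (q : ℝ) (α β : Bit) : ℂ :=
  if α = β then (bitWeight q α : ℂ) else 0

theorem sum_bitWeight_proj (q : ℝ) (s x y : Bit) :
    ∑ f, (bitWeight q f : ℂ) * ((1 + sgn (s + f + x)) / 2 * ((1 + sgn (s + f + y)) / 2)) =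
      flippedReadout q (s + x) (s + y) := by
  rw [sum_bit]
  have e : (1 : Bit) + 1 = 0 := Bit.add_self 1
  rcases s.eq_zero_or_one with rfl | rfl <;> rcases x.eq_zero_or_one with rfl | rfl <;>
    rcases y.eq_zero_or_one with rfl | rfl <;> simp [e, flippedReadout, bitWeight]

/-- Phase flips followed by a measurement of the operators `∏ᵢ Zᵢ` on the supports of the generators
of kind `b`, with flipped outcomes. -/
noncomputable def flipStep (C : CSSCode n) (b : Kind) (q : Fin n → ℝ) (qa : Fin (C.num b) → ℝ)
    (s : Fin (C.num b) → Bit) : Op (Fin n) →ₗ[ℂ] Op (Fin n) :=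
  mulEntries fun x y => (∏ i, if x i = y i then 1 else ((1 - 2 * q i : ℝ) : ℂ)) *
    ∏ a, flippedReadout (qa a) (s a + C.par b a x) (s a + C.par b a y)

theorem zMeasurement_eq (C : CSSCode n) (b : Kind) (q : Fin n → ℝ) (qa : Fin (C.num b) → ℝ)
    (s : Fin (C.num b) → Bit) (ρ : Op (Fin n)) :
    ∑ f : Fin (C.num b) → Bit, (flipWeight qa f : ℂ) • (zProjector C b (s + f) *
      flipNoise .Z q ρ * (zProjector C b (s + f)).conjTranspose) = flipStep C b q qa s ρ := by
  ext x y
  have hstar : ∀ z, star ((1 + sgn z) / 2) = (1 + sgn z) / 2 := fun z => by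
    rcases z.eq_zero_or_one with rfl | rfl <;> simp
  simp only [zProjector_eq, Matrix.diagonal_conjTranspose, Matrix.sum_apply, Matrix.smul_apply,
    Matrix.mul_diagonal, Matrix.diagonal_mul, flipNoise_Z_apply, flipStep, mulEntries_apply,
    ← sum_bitWeight_proj, prod_sum_pi, Finset.sum_mul, Finset.mul_sum, smul_eq_mul, flipWeight_eq,
    Pi.star_apply, star_prod, hstar, Pi.add_apply, Finset.prod_mul_distrib]
  refine Finset.sum_congr rfl fun f _ => by ring

theorem flippedMeasurement_Z (C : CSSCode n) (q : Fin n → ℝ) (qa : Fin (C.num .Z) → ℝ)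
    (s : Fin (C.num .Z) → Bit) (ρ : Op (Fin n)) :
    C.flippedMeasurement .Z qa s (flipNoise .Z q ρ) = flipStep C .Z q qa s ρ :=
  zMeasurement_eq C .Z q qa s ρ

/-- Conjugation by Hadamard gates as a homomorphism. -/
noncomputable def hadConjHom (n : ℕ) : Op (Fin n) →* Op (Fin n) where
  toFun := hadConj
  map_one' := hadConj_one
  map_mul' := hadConj_mul

theorem hadConj_projector_X (C : CSSCode n) (s : Fin (C.num .X) → Bit) :
    hadConj (C.projector .X s) = zProjector C .X s := by
  have h : hadConj (C.projector .X s) = hadConjHom n (C.projector .X s) := rfl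
  rw [h, CSSCode.projector, map_list_prod, List.map_ofFn, zProjector]
  congr 2
  ext1 a
  change hadConj _ = _
  rw [map_smul, map_add, hadConj_one, map_smul, CSSCode.stab, hadConj_pauliOp_X]
  rfl

theorem hadConj_flipNoise_X (q : Fin n → ℝ) (ρ : Op (Fin n)) :
    hadConj (flipNoise .X q ρ) = flipNoise .Z q (hadConj ρ) := by
  simp only [flipNoise, map_sum, map_smul, hadConj_mul, hadConj_conjTranspose, hadConj_pauliOp_X]

/-- An `X` layer is a `Z`-type step between two layers of Hadamard gates. In a full round the second
of these is the one with which the following layer of the foliation begins. -/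
theorem flippedMeasurement_X (C : CSSCode n) (q : Fin n → ℝ) (qa : Fin (C.num .X) → ℝ)
    (s : Fin (C.num .X) → Bit) (ρ : Op (Fin n)) :
    C.flippedMeasurement .X qa s (flipNoise .X q ρ) =
      hadConj (flipStep C .X q qa s (hadConj ρ)) := by
  rw [← hadConj_hadConj (C.flippedMeasurement .X qa s (flipNoise .X q ρ)), ← zMeasurement_eq]
  simp only [CSSCode.flippedMeasurement, map_sum, map_smul, hadConj_mul, hadConj_conjTranspose,
    hadConj_projector_X, hadConj_flipNoise_X]

/-! ### Invariance under the stabilizers -/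

/-- The other kind of stabilizers. -/
def Kind.other : Kind → Kind
  | .X => .Z
  | .Z => .X

/-- Invariance under conjugation by all stabilizers before a layer of kind `b`, up to Hadamard gates
on all qubits if `b = Z`. -/
structure StabInvariant (C : CSSCode n) (b : Kind) (ρ : Op (Fin n)) : Prop where
  flip : ∀ a, frameConj (C.ind b a) 0 ρ = ρ
  phase : ∀ a, frameConj 0 (C.ind b.other a) ρ = ρ

theorem CSSCode.IsCodeOp.stabInvariant {ρ : Op (Fin n)} (h : C.IsCodeOp ρ) :
    StabInvariant C .X ρ := by
  constructor
  · intro a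
    have := h .X a
    rw [← pauliOp_X_conj]
    change C.stab .X a * ρ * C.stab .X a = ρ
    rw [this.1, this.2]
  · intro a
    have := h .Z a
    rw [← pauliOp_Z_conj]
    change C.stab .Z a * ρ * C.stab .Z a = ρ
    rw [this.1, this.2]

/-- Commutation of the generators, as an even overlap: flipping along a generator of one kind does
not change the syndromes of the other. -/
theorem CSSCode.par_ind_other (C : CSSCode n) (b : Kind) (a : Fin (C.num b))
    (a' : Fin (C.num b.other)) : C.par b a (C.ind b.other a') = 0 := by
  have h : C.par b a (C.ind b.other a') = ((C.supp b a ∩ C.supp b.other a').card : Bit) := by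
    simp [CSSCode.par, CSSCode.ind, Finset.sum_ite_mem]
  rw [h, ZMod.natCast_eq_zero_iff_even]
  cases b
  · exact C.comm a a'
  · rw [Finset.inter_comm]; exact C.comm a' a

theorem frameConj_mulEntries (f g : Fin n → Bit) (M : (Fin n → Bit) → (Fin n → Bit) → ℂ)
    (hM : ∀ x y, M (x + f) (y + f) = M x y) (ρ : Op (Fin n)) :
    frameConj f g (mulEntries M ρ) = mulEntries M (frameConj f g ρ) := by
  ext x y
  simp only [frameConj, Matrix.of_apply, mulEntries_apply, hM]; ring

theorem Kind.other_other (b : Kind) : b.other.other = b := by cases b <;> rfl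

/-- The Hadamard gates exchange the two invariances. Entrywise factors commute with phases, and with
flips along the other kind of generators because these preserve both `x i = y i` and the parities.
Flips leave the code space, which is why invariance is required under conjugation only. -/
theorem StabInvariant.flipStep {b : Kind} {ρ : Op (Fin n)} (h : StabInvariant C b ρ)
    (q : Fin n → ℝ) (qa : Fin (C.num b) → ℝ) (s : Fin (C.num b) → Bit) :
    StabInvariant C b.other (flipStep C b q qa s (hadConj ρ)) := by
  constructor
  · intro a
    rw [Foliation.flipStep, frameConj_mulEntries, ← hadConj_frameConj, h.phase]
    intro x y
    simp only [Pi.add_apply, add_left_inj, CSSCode.par_add, CSSCode.par_ind_other, add_zero]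
  · rw [b.other_other]
    intro a
    rw [Foliation.flipStep, frameConj_mulEntries, ← hadConj_frameConj, h.flip]
    intro x y
    simp only [add_zero]

/-- After the Hadamard gates the stabilizer is diagonal, and conjugation by it negates an entry
between different parities; by invariance that entry equals its own negative. -/
theorem hadConj_apply_eq_zero {b : Kind} {ρ : Op (Fin n)} (h : StabInvariant C b ρ)
    (a : Fin (C.num b)) {x y : Fin n → Bit} (hxy : C.par b a x ≠ C.par b a y) :
    hadConj ρ x y = 0 := by
  have h1 := congrFun (congrFun (congrArg hadConj (h.flip a)) x) y
  rw [hadConj_frameConj] at h1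
  have h2 : sgn (C.par b a x + C.par b a y) = -1 := by
    rcases (C.par b a x).eq_zero_or_one with hx | hx <;>
      rcases (C.par b a y).eq_zero_or_one with hy | hy <;> simp [hx, hy] at hxy ⊢
  simp only [frameConj, Matrix.of_apply, add_zero, CSSCode.ind_dotProduct, CSSCode.par_add,
    h2] at h1
  linear_combination -h1 / 2

theorem IsDephFactor.readout_self {f : Bit → Bit → ℂ} (hf : IsDephFactor f) (α : Bit) :
    readout f α α = (bitWeight ((1 - (f 0 1).re) / 2) α : ℂ) := by
  have h10 : f 1 0 = star (f 0 1) := (hf.conj 0 1).symm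
  have h := Complex.add_conj (f 0 1)
  push_cast at h
  simp only [readout, sum_bit, hf.diag, h10]
  rcases α.eq_zero_or_one with rfl | rfl <;> simp [bitWeight]
  · linear_combination h / 4
  · linear_combination -h / 4

theorem meanLayer_eq_flipStep {N : Loc C → SuperOp1} (hN : DephasingNoise L N) {q : Site C → ℝ}
    (hq : ∀ γ : Site C, γ.round < L → q γ = (1 - (siteFactor L N γ 0 1).re) / 2) (k : Fin L)
    (b : Kind) (s : Fin (C.num b) → Bit) {ρ : Op (Fin n)} (h : StabInvariant C b ρ) :
    meanLayer L N k b s ρ =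
      flipStep C b (fun i => q (.code k b i)) (fun a => q (.anc k b a)) s (hadConj ρ) := by
  ext x y
  rw [meanLayer, LinearMap.comp_apply, flipStep, mulEntries_apply, mulEntries_apply]
  by_cases hxy : ∀ a, C.par b a x = C.par b a y
  · congr 2
    · refine Finset.prod_congr rfl fun i _ => ?_
      rw [meanFactor, hq (.code k b i) k.2]
      congr 2; ring
    · refine Finset.prod_congr rfl fun a _ => ?_
      rw [hxy a, (hN.siteFactor (γ := .anc k b a) k.2).readout_self, flippedReadout, if_pos rfl,
        hq (.anc k b a) k.2]
  -- The coherent readout factor need not vanish here, whereas the flip model's does; the entry of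
  -- the state itself is zero.
  · push Not at hxy
    obtain ⟨a, ha⟩ := hxy
    rw [hadConj_apply_eq_zero h a ha, mul_zero, mul_zero]

/-- The foliation with dephasing noise is the code under flips. -/
theorem foliationOutput_eq_flipModelOutput (S : Schedule C L) {N : Loc C → SuperOp1}
    (hN : DephasingNoise L N) {q : Site C → ℝ}
    (hq : ∀ γ : Site C, γ.round < L → q γ = (1 - (siteFactor L N γ 0 1).re) / 2)
    (σ : StabOutcomes C L) {ρ : Op (Fin n)} (hρ : C.IsCodeOp ρ) :
    foliationOutput S N σ ρ = flipModelOutput C q σ ρ := by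
  rw [foliationOutput_eq_foldl S hN, flipModelOutput]
  refine (foldl_finRange_rel _ _ (fun _ ρ τ => ρ = τ ∧ StabInvariant C .X ρ)
    ⟨rfl, hρ.stabInvariant⟩ ?_).1
  rintro k ρ _ ⟨rfl, h⟩
  have h1 := h.flipStep (fun i => q (.code k .X i)) (fun a => q (.anc k .X a))
    (frameSyndrome σ k .X)
  have h2 := h1.flipStep (fun i => q (.code k .Z i)) (fun a => q (.anc k .Z a))
    (frameSyndrome σ k .Z)
  rw [meanLayer_eq_flipStep hN hq k .X _ h, meanLayer_eq_flipStep hN hq k .Z _ h1]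
  refine ⟨?_, h2⟩
  beta_reduce
  rw [flippedMeasurement_X, flippedMeasurement_Z]

/-! ### Computing the Pauli channels -/

namespace MulProg

/-- Multiply the matrices of a nonempty list. -/
def ofList {ι : Type} : ι → List ι → MulProg ι
  | l, [] => .input l
  | l, l' :: t => .mul (.input l) (ofList l' t)

theorem inputs_ofList {ι : Type} (l : ι) (t : List ι) : (ofList l t).inputs = l :: t := by
  induction t generalizing l with
  | nil => rfl
  | cons l' t ih => simp [ofList, inputs, ih]

theorem mults_ofList {ι : Type} (l : ι) (t : List ι) : (ofList l t).mults = t.length := by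
  induction t generalizing l with
  | nil => rfl
  | cons l' t ih => simp [ofList, mults, ih]

theorem eval_ofList {ι : Type} (v : ι → Matrix Pauli Pauli ℂ) (μ : ι → ℂ) (l : ι) (t : List ι)
    (h : ∀ j ∈ l :: t, v j = dephPtm (μ j)) :
    (ofList l t).eval v = dephPtm ((l :: t).map μ).prod := by
  induction t generalizing l with
  | nil => simpa [ofList, eval] using h
  | cons l' t ih =>
    rw [ofList, eval, eval, ih l' fun j hj => h j (List.mem_cons_of_mem _ hj),
      h l List.mem_cons_self, dephPtm_mul]
    simp only [List.map_cons, List.prod_cons]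

end MulProg

/-- The location after the preparation of a physical qubit. -/
def Site.prepLoc : Site C → Loc C
  | .code k b i => .codePrep k b i
  | .anc k b a => .ancPrep k b a

theorem Site.prepLoc_isPrep (γ : Site C) : γ.prepLoc.isPrep := by cases γ <;> trivial

theorem Site.locs_eq_cons (γ : Site C) : γ.locs L = γ.prepLoc :: (γ.locs L).tail := by
  cases γ <;> simp [Site.locs, Site.prepLoc]

theorem Site.not_isPrep_of_mem_tail (γ : Site C) (l : Loc C) (h : l ∈ (γ.locs L).tail) :
    ¬ l.isPrep := by
  cases γ with
  | code k b i =>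
    simp only [Site.locs, List.cons_append, List.tail_cons, List.mem_append, List.mem_cons,
      List.mem_map, List.nil_append] at h
    rcases h with rfl | ⟨a, -, rfl⟩ | h
    · simp [Loc.isPrep]
    · simp [Loc.isPrep]
    · split_ifs at h
      · simp at h
      · rw [List.mem_singleton] at h; subst h; simp [Loc.isPrep]
  | anc k b a =>
    simp only [Site.locs, List.tail_cons, List.mem_map] at h
    obtain ⟨i, -, rfl⟩ := h
    simp [Loc.isPrep]

/-- The program that multiplies the transfer matrices at all locations of a physical qubit. -/
def siteProg (C : CSSCode n) (L : ℕ) (γ : Site C) : MulProg (Loc C) :=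
  .ofList γ.prepLoc (γ.locs L).tail

theorem Site.W_le (γ : Site C) : γ.W L ≤ max (C.maxWeight + 1) (C.maxDegree + 3) := by
  have hlen : ∀ {r : ℕ} (s : Finset (Fin r)),
      ((List.finRange r).filter fun i => i ∈ s).length = s.card := fun s => by
    rw [← List.toFinset_card_of_nodup ((List.nodup_finRange _).filter _)]
    congr 1
    ext i; simp
  cases γ with
  | code k b i =>
    have hd : C.degree b i ≤ C.maxDegree :=
      (Finset.le_sup (f := fun i => C.degree b i) (Finset.mem_univ i)).trans
        (Finset.le_sup (f := fun b => Finset.univ.sup fun i => C.degree b i) (Finset.mem_univ b))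
    have h := hlen (Finset.univ.filter fun a => i ∈ C.supp b a)
    simp only [Finset.mem_filter, Finset.mem_univ, true_and] at h
    refine le_trans ?_ (le_max_right _ _)
    simp only [Site.W, Site.locs, List.length_append, List.length_map, h, List.length_cons,
      List.length_nil]
    rw [CSSCode.degree] at hd
    split_ifs <;> simp <;> omega
  | anc k b a =>
    have hw : (C.supp b a).card ≤ C.maxWeight :=
      (Finset.le_sup (f := fun a => (C.supp b a).card) (Finset.mem_univ a)).trans
        (Finset.le_sup (f := fun b => Finset.univ.sup fun a => (C.supp b a).card)
          (Finset.mem_univ b))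
    refine le_trans ?_ (le_max_left _ _)
    simp only [Site.W, Site.locs, List.length_map, hlen, List.length_cons]
    omega

theorem xEntry_eq {N : Loc C → SuperOp1} (hN : DephasingNoise L N) {γ : Site C}
    (hγ : γ.round < L) : xEntry (siteProg C L) N γ = (siteFactor L N γ 0 1).re := by
  rw [xEntry, siteProg, MulProg.eval_ofList _ (fun l => dephFactor (N l) 0 1), ← Site.locs_eq_cons]
  · rfl
  · intro l hl
    rw [← Site.locs_eq_cons] at hl
    exact ptm_of_isDephasing (hN l (Site.occurs_of_mem hγ hl))

theorem abs_xEntry_le {N : Loc C → SuperOp1} (hN : DephasingNoise L N) {γ : Site C}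
    (hγ : γ.round < L) : |xEntry (siteProg C L) N γ| ≤ 1 := by
  rw [xEntry_eq hN hγ]
  exact (Complex.abs_re_le_norm _).trans ((hN.siteFactor hγ).norm_le 0 1)

theorem locFlip_mem_Icc {prog : Site C → MulProg (Loc C)} {N : Loc C → SuperOp1} {l : Loc C}
    (h : |xEntry prog N l.site| ≤ 1) : locFlip L prog N l ∈ Set.Icc (0 : ℝ) 1 := by
  have h0 : 0 ≤ |xEntry prog N l.site| ^ ((1 : ℝ) / (l.site.W L : ℝ)) :=
    Real.rpow_nonneg (abs_nonneg _) _
  have h1 : |xEntry prog N l.site| ^ ((1 : ℝ) / (l.site.W L : ℝ)) ≤ 1 :=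
    Real.rpow_le_one (abs_nonneg _) h (by positivity)
  simp only [locFlip]
  split_ifs <;> constructor <;> linarith

/-- The product of the factors `1 - 2 p` over the locations of a physical qubit. -/
theorem prod_locFlip (prog : Site C → MulProg (Loc C)) (N : Loc C → SuperOp1) (γ : Site C) :
    ((γ.locs L).map fun l => 1 - 2 * locFlip L prog N l).prod = xEntry prog N γ := by
  classical
  set x := xEntry prog N γ with hx
  set r := |x| ^ ((1 : ℝ) / (γ.W L : ℝ)) with hr
  have hW : γ.W L = (γ.locs L).tail.length + 1 := by
    rw [Site.W, Site.locs_eq_cons, List.length_cons, List.tail_cons]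
  have hrW : r ^ γ.W L = |x| := by
    rw [hr, one_div, Real.rpow_inv_natCast_pow (abs_nonneg x) (by omega)]
  have hloc : ∀ l ∈ γ.locs L, 1 - 2 * locFlip L prog N l =
      if x < 0 ∧ (Odd (γ.W L) ∨ l.isPrep) then -r else r := fun l hl => by
    simp only [locFlip, γ.mem_locs_site l hl, ← hx, ← hr]
    split_ifs <;> ring
  have htail : (γ.locs L).tail.map (fun l => 1 - 2 * locFlip L prog N l) =
      List.replicate (γ.locs L).tail.length (if x < 0 ∧ Odd (γ.W L) then -r else r) := by
    rw [List.eq_replicate_iff]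
    refine ⟨by simp, fun c hc => ?_⟩
    obtain ⟨l, hl, rfl⟩ := List.mem_map.1 hc
    rw [hloc l (List.mem_of_mem_tail hl)]
    simp only [γ.not_isPrep_of_mem_tail l hl, or_false]
  rw [Site.locs_eq_cons, List.map_cons, List.prod_cons, htail, List.prod_replicate,
    hloc _ (by rw [Site.locs_eq_cons]; exact List.mem_cons_self)]
  simp only [γ.prepLoc_isPrep, or_true, and_true]
  -- For `x < 0`, odd `W` gives `(-r)^W = -|x|`; for even `W` the single minus sign at the
  -- preparation gives `-r * r^(W-1) = -|x|`.
  by_cases h0 : x < 0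
  · rw [abs_of_neg h0] at hrW
    by_cases hodd : Odd (γ.W L)
    · simp only [h0, hodd, and_self, if_true]
      rw [← pow_succ', ← hW, hodd.neg_pow, hrW, neg_neg]
    · simp only [h0, hodd, and_false, if_true, if_false]
      rw [neg_mul, ← pow_succ', ← hW, hrW, neg_neg]
  · rw [abs_of_nonneg (not_lt.1 h0)] at hrW
    simp only [h0, false_and, if_false]
    rw [← pow_succ', ← hW, hrW]

theorem dephasingNoise_pauliReplacement {N : Loc C → SuperOp1} (hN : DephasingNoise L N) :
    DephasingNoise L (pauliReplacement L (siteProg C L) N) := fun _ hl =>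
  (phaseFlip_isDephasing (locFlip_mem_Icc (abs_xEntry_le hN hl.1))).1

theorem siteFactor_pauliReplacement {N : Loc C → SuperOp1} (hN : DephasingNoise L N) {γ : Site C}
    (hγ : γ.round < L) :
    siteFactor L (pauliReplacement L (siteProg C L) N) γ 0 1 = xEntry (siteProg C L) N γ := by
  rw [← prod_locFlip (L := L), siteFactor, ← Complex.ofRealHom_eq_coe, map_list_prod,
    List.map_map]
  congr 1
  refine List.map_congr_left fun l hl => ?_
  have := (phaseFlip_isDephasing (locFlip_mem_Icc
    (abs_xEntry_le hN (Site.occurs_of_mem hγ hl).1) (L := L))).2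
  rw [pauliReplacement, this]
  simp

end Foliation

/-! ### Assembly of the main theorem -/

theorem theorem2 {n : ℕ} (C : Foliation.CSSCode n) (L : ℕ) :
    ∃ prog : Foliation.Site C → Foliation.MulProg (Foliation.Loc C),
      (∀ γ : Foliation.Site C, γ.round < L →
        (prog γ).inputs.Perm (γ.locs L) ∧
        (prog γ).mults + 1 = γ.W L ∧
        γ.W L ≤ max (C.maxWeight + 1) (C.maxDegree + 3)) ∧
      ∀ N : Foliation.Loc C → Foliation.SuperOp1,
        (∀ l, l.Occurs L → Foliation.IsChannel (N l) ∧ Foliation.PureZ (N l)) →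
        (∀ l, l.Occurs L →
          Foliation.IsPauliChannel (Foliation.pauliReplacement L prog N l)) ∧
        (∀ γ : Foliation.Site C, γ.round < L → Foliation.totalFlip prog N γ ∈ Set.Icc 0 1) ∧
        ∀ (S : Foliation.Schedule C L) (ρ : Foliation.Op (Fin n)), C.IsCodeOp ρ →
          ∀ σ : Foliation.StabOutcomes C L,
            Foliation.foliationOutput S N σ ρ =
              Foliation.foliationOutput S (Foliation.pauliReplacement L prog N) σ ρ ∧
            Foliation.foliationOutput S N σ ρ =
              Foliation.flipModelOutput C (Foliation.totalFlip prog N) σ ρ := by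
  open Foliation in
  refine ⟨siteProg C L, fun γ _ => ⟨?_, ?_, γ.W_le⟩, fun N h => ?_⟩
  · rw [siteProg, MulProg.inputs_ofList, ← Site.locs_eq_cons]
  · rw [siteProg, MulProg.mults_ofList, Site.W, γ.locs_eq_cons, List.length_cons, List.tail_cons]
  have hN : DephasingNoise L N := fun l hl => isDephasing_of_channel (h l hl).1 (h l hl).2.2
  refine ⟨fun l hl => phaseFlip_isPauliChannel (locFlip_mem_Icc (abs_xEntry_le hN hl.1)),
    fun γ hγ => ?_, fun S ρ hρ σ => ?_⟩
  · have := abs_le.1 (abs_xEntry_le hN hγ)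
    rw [totalFlip]
    constructor <;> linarith
  · have h1 := foliationOutput_eq_flipModelOutput S hN (q := totalFlip (siteProg C L) N)
      (fun γ hγ => by rw [totalFlip, xEntry_eq hN hγ]) σ hρ
    -- The replacement has the same value of `Re μ` on every physical qubit, so the flip model is
    -- literally the same one.
    have h2 := foliationOutput_eq_flipModelOutput S (dephasingNoise_pauliReplacement hN)
      (q := totalFlip (siteProg C L) N)
      (fun γ hγ => by rw [totalFlip, siteFactor_pauliReplacement hN hγ, Complex.ofReal_re]) σ hρ
    exact ⟨h1.trans h2.symm, h1⟩
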